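/- \textbf{Arrow terms.} Formulae are built from a nonempty set of letters with one binary connective $\wedge$. Arrow terms are $\mathbf 1_A\colon A\to A$, $c^m_{A,B,C,D}\colon (A\wedge B)\wedge(C\wedge D)\to(A\wedge C)\wedge(B\wedge D)$, and are closed under composition $g\circ f$ (for composable types) and under $f\wedge g\colon A\wedge C\to B\wedge D$ for $f\colon A\to B$, $g\colon C\to D$. For a letter $p$ let $p^0=p$ and $p^{n+1}=p^n\wedge p^n$. The arrow terms of $\mathbf{C^m}(p^n)$, a category with the single object $p^n$, are: $\mathbf 1_{p^n}$; for $n\ge 2$, $c^m_{p^{n-2},p^{n-2},p^{n-2},p^{n-2}}$; for $n\ge 1$, $f\wedge g$ with $f,g$ arrow terms of $\mathbf{C^m}(p^{n-1})$; and $g\circ f$ with $f,g$ arrow terms of $\mathbf{C^m}(p^n)$. \textbf{Abbreviations.} Arrow terms $i^n_{j,j+1}$ of $\mathbf{C^m}(p^n)$, for $1\le i\le n-1$ and $1\le j\le\binom ni-1$, are defined as follows, where for $j<k$ $$i^n_{j,k}=i^n_{j,j+1}\circ\dots\circ i^n_{k-2,k-1}\circ i^n_{k-1,k}\circ i^n_{k-2,k-1}\circ\dots\circ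 i^n_{j,j+1}.$$ First, $1^2_{1,2}=c^m_{p,p,p,p}$. For $n\ge2$ and $1\le i\le n$, $i^{n+1}_{j,j+1}$ is $i^n_{j,j+1}\wedge\mathbf 1_{p^n}$ if $j<\binom ni$, and is $\mathbf 1_{p^n}\wedge(i-1)^n_{j-\binom ni,\,j-\binom ni+1}$ if $j>\binom ni$. With $\gamma=c^m_{p^{n-1},p^{n-1},p^{n-1},p^{n-1}}$, $\alpha=i^{n+1}_{\binom{n-1}i,\binom{n-1}i+1}$ and $\beta=i^{n+1}_{\binom{n-1}i+1,\binom ni}$, the term $i^{n+1}_{\binom ni,\binom ni+1}$ is $\alpha\circ\gamma\circ\alpha\circ\gamma\circ\alpha$ if $i=1$; it is $n^{n+1}_{2,3}\circ\gamma\circ n^{n+1}_{2,3}\circ\gamma\circ n^{n+1}_{2,3}$ if $i=n$; and it is $\beta\circ\alpha\circ\gamma\circ\alpha\circ\gamma\circ\alpha\circ\beta$ if $2\le i\le n-1$. \textbf{Equations.} Equality of arrow terms in the categories $\mathbf{C^m}(p^n)$ is the smallest family of equivalence relations, congruent with respect to $\circ$ and $\wedge$, that contains the categorial equations, the bifunctorial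 equations for $\wedge$, the naturality equation $((f\wedge h)\wedge(g\wedge j))\circ c^m=c^m\circ((f\wedge g)\wedge(h\wedge j))$, the equation $c^m\circ c^m=\mathbf 1$ and, in $\mathbf{C^m}(p^{n+1})$ for $n\ge2$, the equations \begin{itemize} \item (norm) $i^{n+1}_{k,k+1}\circ j^{n+1}_{l,l+1}=j^{n+1}_{l,l+1}\circ i^{n+1}_{k,k+1}$ for $i\ne j$; \item (YB) $i^{n+1}_{j,j+1}\circ i^{n+1}_{j+1,j+2}\circ i^{n+1}_{j,j+1}=i^{n+1}_{j+1,j+2}\circ i^{n+1}_{j,j+1}\circ i^{n+1}_{j+1,j+2}$; \item (def $c^m$) $c^m_{p^{n-1},p^{n-1},p^{n-1},p^{n-1}}=\prod_{1\le i\le n}\bigl(i^{n+1}_{\binom{n-1}i+1,\binom ni+1}\circ\dots\circ i^{n+1}_{\binom ni,\binom ni+\binom{n-1}{i-1}}\bigr)$, where $\prod_{1\le i\le n}f(i)$ stands for $f(1)\circ\dots\circ f(n)$; \item (perm), for $n\ge3$: $i^{n+1}_{j,j+1}\circ i^{n+1}_{j+k,j+k+1}=i^{n+1}_{j+k,j+k+1}\circ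 i^{n+1}_{j,j+1}$ for $k\ge2$. \end{itemize} The category $\mathbf{C^m}$ has the formulae as objects. Its arrows are the arrow terms modulo the congruence generated by the categorial, bifunctorial, naturality and isomorphism ($c^m_{A,C,B,D}\circ c^m_{A,B,C,D}=\mathbf 1$) equations and by all equations obtained from an equation that holds in some $\mathbf{C^m}(p^n)$ by deleting the indices and assigning any indices for which both sides become arrow terms of the same type. The functor $G$ from $\mathbf{C^m}$ to the category of finite ordinals and permutations sends $A$ to the number of occurrences of letters in $A$; it sends $\mathbf 1_A$ to the identity, $c^m_{A,B,C,D}$ to the permutation that interchanges the block of $B$ with the block of $C$, $f\wedge g$ to $Gf$ and $Gg$ placed side by side, and $\circ$ to composition. \textbf{Theorem.} \begin{enumerate} \item For every $n\ge0$, the arrows of $\mathbf{C^m}(p^n)$ form a group under composition. For $0\le i\le n$ let $G^n_i$ be its subgroup generated by the arrows $i^n_{j,j+1}$, $1\le j\le\binom ni-1$ (the trivial subgroup for $i=0$ and $i=n$). Then this group is the internal direct product of $G^n_0,\dots,G^n_n$, and $G^n_i$ is isomorphic to the symmetric group $S_{\binom ni}$ for every $i$. \item For every letter $p$ and every $n\geq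 0$, $\mathbf{C^m}(p^n)$ is a full subcategory of $\mathbf{C^m}$. \item $G$ is a well-defined functor, and it is faithful: $\mathbf{C^m}$ is coherent. \end{enumerate} -/

import Mathlib

open CategoryTheory

namespace MedialComm

universe u

/-! ### Formulae and arrow terms of `C^m` -/

/-- Formulae generated by a set `L` of letters with the sole connective `∧`. -/
inductive Form (L : Type u) : Type u
  | letter : L → Form L
  | and : Form L → Form L → Form L

/-- The number of (occurrences of) letters in a formula. -/
def Form.len {L : Type u} : Form L → ℕ
  | .letter _ => 1
  | .and A B => A.len + B.len

/-- `p^0 = p` and `p^(n+1) = p^n ∧ p^n`. -/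
def Form.pow {L : Type u} (p : L) : ℕ → Form L
  | 0 => .letter p
  | n + 1 => .and (Form.pow p n) (Form.pow p n)

/-- Arrow terms of `C^m`; `comp g f` is `g ∘ f`. -/
inductive Term {L : Type u} : Form L → Form L → Type u
  | id (A : Form L) : Term A A
  | cm (A B C D : Form L) : Term ((A.and B).and (C.and D)) ((A.and C).and (B.and D))
  | comp {A B C : Form L} : Term B C → Term A B → Term A C
  | and {A B C D : Form L} : Term A B → Term C D → Term (A.and C) (B.and D)

/-- Arrow terms of `C^m(p^n)`, the one-object category with object `p^n`. Here `cm n` is the term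
`c^m` all of whose four indices are `p^n`; its source and its target are `p^(n+2)`. -/
inductive PTerm : ℕ → Type
  | id (n : ℕ) : PTerm n
  | cm (n : ℕ) : PTerm (n + 2)
  | comp {n : ℕ} : PTerm n → PTerm n → PTerm n
  | and {n : ℕ} : PTerm n → PTerm n → PTerm (n + 1)

/-- What is left of an arrow term when its indices are deleted. -/
inductive Skel : Type
  | id : Skel
  | cm : Skel
  | comp : Skel → Skel → Skel
  | and : Skel → Skel → Skel

def Term.skel {L : Type u} : {A B : Form L} → Term A B → Skel
  | _, _, .id _ => .id
  | _, _, .cm _ _ _ _ => .cm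
  | _, _, .comp g f => .comp g.skel f.skel
  | _, _, .and f g => .and f.skel g.skel

def PTerm.skel : {n : ℕ} → PTerm n → Skel
  | _, .id _ => .id
  | _, .cm _ => .cm
  | _, .comp g f => .comp g.skel f.skel
  | _, .and f g => .and f.skel g.skel

/-! ### The transpositions `i_{j,k}^n` -/

/-- Auxiliary: if `s j` stands for `i_{j,j+1}`, then `swapAux s d j` is `i_{j,j+d+1}`, that is
`s j ∘ … ∘ s (j+d-1) ∘ s (j+d) ∘ s (j+d-1) ∘ … ∘ s j`. -/
def swapAux {n : ℕ} (s : ℕ → PTerm n) : ℕ → ℕ → PTerm n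
  | 0, j => s j
  | d + 1, j => .comp (s j) (.comp (swapAux s d (j + 1)) (s j))

/-- `i_{j,k}` for `j < k`, where `s j` stands for `i_{j,j+1}`. -/
def swap {n : ℕ} (s : ℕ → PTerm n) (j k : ℕ) : PTerm n := swapAux s (k - j - 1) j

/-- `tr n i j` is the term `i_{j,j+1}^n`. It is meaningful for `1 ≤ i ≤ n - 1` and
`1 ≤ j ≤ (n choose i) - 1` (see `Valid`); the other values are never used. In the last clause,
the term constructed is `i_{j,j+1}^{m+1}` with `m = n + 2`. -/
def tr : (n : ℕ) → ℕ → ℕ → PTerm n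
  | 0, _, _ => .id 0
  | 1, _, _ => .id 1
  | 2, _, _ => .cm 0
  | n + 3, i, j =>
    let b := (n + 2).choose i
    let a := (n + 1).choose i
    let s : ℕ → PTerm (n + 3) := fun l =>
      if l < b then .and (tr (n + 2) i l) (.id (n + 2))
      else .and (.id (n + 2)) (tr (n + 2) (i - 1) (l - b))
    let γ : PTerm (n + 3) := .cm (n + 1)
    let α := s a
    let β := swap s (a + 1) b
    if j ≠ b then s j
    else if i = 1 then
      .comp α (.comp γ (.comp α (.comp γ α)))
    else if i = n + 2 then
      .comp (s 2) (.comp γ (.comp (s 2) (.comp γ (s 2))))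
    else
      .comp β (.comp α (.comp γ (.comp α (.comp γ (.comp α β)))))

/-- The range of the indices for which `i_{j,j+1}^n` is defined. -/
def Valid (n i j : ℕ) : Prop := 1 ≤ i ∧ i + 1 ≤ n ∧ 1 ≤ j ∧ j + 1 ≤ n.choose i

/-- `prodUpTo f k` is `f 1 ∘ … ∘ f k` (with an identity in front). -/
def prodUpTo {n : ℕ} (f : ℕ → PTerm n) : ℕ → PTerm n
  | 0 => .id n
  | k + 1 => .comp (prodUpTo f k) (f (k + 1))

/-- The right-hand side of the equation `(def c^m)` for `C^m(p^(n+1))`: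
`∏_{1 ≤ i ≤ n} (i_{a+1,b+1} ∘ … ∘ i_{b,b+d})` with `a = (n-1 choose i)`, `b = (n choose i)`
and `d = (n-1 choose i-1)`, so that `a + d = b`. -/
def cmProd (n : ℕ) : PTerm (n + 1) :=
  prodUpTo (fun i =>
    prodUpTo (fun t =>
      swap (tr (n + 1) i) ((n - 1).choose i + t) (n.choose i + t))
      ((n - 1).choose (i - 1))) n

/-! ### The equations of `C^m(p^n)` -/

/-- Equality of arrow terms in `C^m(p^n)`. -/
inductive PEq : {n : ℕ} → PTerm n → PTerm n → Prop
  | refl {n : ℕ} (f : PTerm n) : PEq f f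
  | symm {n : ℕ} {f g : PTerm n} : PEq f g → PEq g f
  | trans {n : ℕ} {f g h : PTerm n} : PEq f g → PEq g h → PEq f h
  | comp_congr {n : ℕ} {f f' g g' : PTerm n} :
      PEq g g' → PEq f f' → PEq (.comp g f) (.comp g' f')
  | and_congr {n : ℕ} {f f' g g' : PTerm n} :
      PEq f f' → PEq g g' → PEq (.and f g) (.and f' g')
  | comp_id {n : ℕ} (f : PTerm n) : PEq (.comp f (.id n)) f
  | id_comp {n : ℕ} (f : PTerm n) : PEq (.comp (.id n) f) f
  | assoc {n : ℕ} (h g f : PTerm n) : PEq (.comp h (.comp g f)) (.comp (.comp h g) f)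
  | bif1 (n : ℕ) : PEq (.and (.id n) (.id n)) (.id (n + 1))
  | bif2 {n : ℕ} (g₁ f₁ g₂ f₂ : PTerm n) :
      PEq (.and (.comp g₁ f₁) (.comp g₂ f₂)) (.comp (.and g₁ g₂) (.and f₁ f₂))
  | cm_nat {n : ℕ} (f g h j : PTerm n) :
      PEq (.comp (.and (.and f h) (.and g j)) (.cm n))
        (.comp (.cm n) (.and (.and f g) (.and h j)))
  | cm_cm (n : ℕ) : PEq (.comp (.cm n) (.cm n)) (.id (n + 2))
  | norm {n i j k l : ℕ} : 3 ≤ n → i ≠ j → Valid n i k → Valid n j l →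
      PEq (.comp (tr n i k) (tr n j l)) (.comp (tr n j l) (tr n i k))
  | yb {n i j : ℕ} : 3 ≤ n → Valid n i j → Valid n i (j + 1) →
      PEq (.comp (tr n i j) (.comp (tr n i (j + 1)) (tr n i j)))
        (.comp (tr n i (j + 1)) (.comp (tr n i j) (tr n i (j + 1))))
  | def_cm (n : ℕ) : PEq (.cm (n + 1)) (cmProd (n + 2))
  | perm {n i j k : ℕ} : 4 ≤ n → 2 ≤ k → Valid n i j → Valid n i (j + k) →
      PEq (.comp (tr n i j) (tr n i (j + k))) (.comp (tr n i (j + k)) (tr n i j))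

/-! ### The equations of `C^m` -/

/-- Equality of arrow terms of `C^m`: the congruence generated by the categorial, bifunctorial,
naturality and isomorphism equations, and by the equations obtained from those that hold in some
`C^m(p^n)` by deleting the indices and putting in any indices for which both sides become arrow
terms of the same type (that is, the instances of the most general such indices). -/
inductive CEq {L : Type u} : {A B : Form L} → Term A B → Term A B → Prop
  | refl {A B : Form L} (f : Term A B) : CEq f f
  | symm {A B : Form L} {f g : Term A B} : CEq f g → CEq g f
  | trans {A B : Form L} {f g h : Term A B} : CEq f g → CEq g h → CEq f h
  | comp_congr {A B C : Form L} {f f' : Term A B} {g g' : Term B C} :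
      CEq g g' → CEq f f' → CEq (.comp g f) (.comp g' f')
  | and_congr {A B C D : Form L} {f f' : Term A B} {g g' : Term C D} :
      CEq f f' → CEq g g' → CEq (.and f g) (.and f' g')
  | comp_id {A B : Form L} (f : Term A B) : CEq (.comp f (.id A)) f
  | id_comp {A B : Form L} (f : Term A B) : CEq (.comp (.id B) f) f
  | assoc {A B C D : Form L} (h : Term C D) (g : Term B C) (f : Term A B) :
      CEq (.comp h (.comp g f)) (.comp (.comp h g) f)
  | bif1 (A B : Form L) : CEq (.and (.id A) (.id B)) (.id (A.and B))
  | bif2 {A₁ B₁ C₁ A₂ B₂ C₂ : Form L} (g₁ : Term B₁ C₁) (f₁ : Term A₁ B₁)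
      (g₂ : Term B₂ C₂) (f₂ : Term A₂ B₂) :
      CEq (.and (.comp g₁ f₁) (.comp g₂ f₂)) (.comp (.and g₁ g₂) (.and f₁ f₂))
  | cm_nat {A B C D A' B' C' D' : Form L} (f : Term A A') (g : Term B B') (h : Term C C')
      (j : Term D D') :
      CEq (.comp (.and (.and f h) (.and g j)) (.cm A B C D))
        (.comp (.cm A' B' C' D') (.and (.and f g) (.and h j)))
  | cm_cm (A B C D : Form L) :
      CEq (.comp (.cm A C B D) (.cm A B C D)) (.id ((A.and B).and (C.and D)))
  | of_pterm {A B : Form L} {f g : Term A B} {n : ℕ} {u v : PTerm n} :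
      PEq u v → f.skel = u.skel → g.skel = v.skel → CEq f g

/-! ### The group `C^m(p^n)` -/

def pSetoid (n : ℕ) : Setoid (PTerm n) := ⟨PEq, PEq.refl, PEq.symm, PEq.trans⟩

/-- The arrows of `C^m(p^n)`. -/
def PHom (n : ℕ) : Type := Quotient (pSetoid n)

def PHom.mk {n : ℕ} (f : PTerm n) : PHom n := Quotient.mk (pSetoid n) f

/-- The inverse of an arrow term. -/
def PTerm.inv : {n : ℕ} → PTerm n → PTerm n
  | _, .id n => .id n
  | _, .cm n => .cm n
  | _, .comp g f => .comp f.inv g.inv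
  | _, .and f g => .and f.inv g.inv

theorem PTerm.inv_comp : ∀ {n : ℕ} (f : PTerm n), PEq (.comp f.inv f) (.id n)
  | _, .id n => PEq.comp_id _
  | _, .cm n => PEq.cm_cm n
  | _, .comp g f =>
    (PEq.assoc _ _ _).trans <|
      (PEq.comp_congr
        ((PEq.assoc _ _ _).symm.trans
          ((PEq.comp_congr (PEq.refl _) g.inv_comp).trans (PEq.comp_id _)))
        (PEq.refl f)).trans f.inv_comp
  | _, .and f g =>
    (PEq.bif2 _ _ _ _).symm.trans
      ((PEq.and_congr f.inv_comp g.inv_comp).trans (PEq.bif1 _))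

/-- Multiplication is composition and the unit element is the identity arrow. -/
instance PHom.instMonoid (n : ℕ) : Monoid (PHom n) where
  mul := Quotient.map₂ PTerm.comp fun _ _ hg _ _ hf => PEq.comp_congr hg hf
  one := PHom.mk (.id n)
  mul_assoc := by
    rintro ⟨h⟩ ⟨g⟩ ⟨f⟩
    exact Quotient.sound (PEq.assoc h g f).symm
  one_mul := by
    rintro ⟨f⟩
    exact Quotient.sound (PEq.id_comp f)
  mul_one := by
    rintro ⟨f⟩
    exact Quotient.sound (PEq.comp_id f)

theorem PHom.mk_mul_mk {n : ℕ} (g f : PTerm n) :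
    PHom.mk g * PHom.mk f = PHom.mk (.comp g f) := rfl

theorem PHom.mk_id (n : ℕ) : PHom.mk (.id n) = 1 := rfl

theorem PHom.mk_inv_mul {n : ℕ} (f : PTerm n) : PHom.mk f.inv * PHom.mk f = 1 :=
  Quotient.sound f.inv_comp

theorem PTerm.inv_congr {n : ℕ} {f g : PTerm n} (h : PEq f g) : PEq f.inv g.inv := by
  have hfg : PHom.mk f = PHom.mk g := Quotient.sound h
  have hinv : ∀ f : PTerm n, PHom.mk f * PHom.mk f.inv = 1 := fun f => by
    have h1 := PHom.mk_inv_mul f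
    have h2 := PHom.mk_inv_mul f.inv
    have h3 : PHom.mk f.inv.inv = PHom.mk f := left_inv_eq_right_inv h2 h1
    rw [← h3]
    exact h2
  have hl : PHom.mk f.inv * PHom.mk g = 1 := by
    rw [← hfg]
    exact PHom.mk_inv_mul f
  have e : PHom.mk f.inv = PHom.mk g.inv := left_inv_eq_right_inv hl (hinv g)
  exact Quotient.exact (s := pSetoid n) e

/-- The category `C^m(p^n)` is a group. -/
instance PHom.instGroup (n : ℕ) : Group (PHom n) where
  inv := Quotient.map PTerm.inv fun _ _ h => PTerm.inv_congr h
  inv_mul_cancel := by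
    rintro ⟨f⟩
    exact PHom.mk_inv_mul f

/-- The subgroup `G_i^n`, generated by the `i_{j,j+1}^n`; it is generated by the empty set for
`i = 0` and for `i = n`. -/
def subG (n i : ℕ) : Subgroup (PHom n) :=
  Subgroup.closure {x | ∃ j, Valid n i j ∧ x = PHom.mk (tr n i j)}

/-- `K` is the internal direct product of the subgroups `H i`: elements of different `H i` commute,
and the multiplication map from the product of the `H i` to `K` is bijective. -/
def IsInternalDirectProduct {K ι : Type*} [Group K] [Fintype ι] (H : ι → Subgroup K) : Prop :=
  ∃ hcomm : Pairwise fun i j : ι => ∀ x y : K, x ∈ H i → y ∈ H j → Commute x y,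
    Function.Bijective (Subgroup.noncommPiCoprod hcomm)

/-! ### The category `C^m` -/

def cSetoid {L : Type u} (A B : Form L) : Setoid (Term A B) :=
  ⟨CEq, CEq.refl, CEq.symm, CEq.trans⟩

/-- The category `C^m`: its objects are the formulae and its arrows are the equivalence classes of
arrow terms. -/
instance instCategoryForm (L : Type u) : Category (Form L) where
  Hom A B := Quotient (cSetoid A B)
  id A := Quotient.mk (cSetoid A A) (.id A)
  comp f g := Quotient.map₂ (fun f g => Term.comp g f)
    (fun _ _ hf _ _ hg => CEq.comp_congr hg hf) f g
  id_comp := by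
    rintro A B ⟨f⟩
    exact Quotient.sound (CEq.comp_id f)
  comp_id := by
    rintro A B ⟨f⟩
    exact Quotient.sound (CEq.id_comp f)
  assoc := by
    rintro A B C D ⟨f⟩ ⟨g⟩ ⟨h⟩
    exact Quotient.sound (CEq.assoc h g f)

/-- The arrow of `C^m` denoted by an arrow term. -/
def Term.toHom {L : Type u} {A B : Form L} (f : Term A B) : A ⟶ B := Quotient.mk (cSetoid A B) f

/-- An arrow term of `C^m(p^n)` as an arrow term of `C^m` of type `p^n → p^n`. -/
def PTerm.toTerm {L : Type u} (p : L) :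
    {n : ℕ} → PTerm n → Term (Form.pow p n) (Form.pow p n)
  | _, .id n => .id (Form.pow p n)
  | _, .cm n => .cm (Form.pow p n) (Form.pow p n) (Form.pow p n) (Form.pow p n)
  | _, .comp g f => .comp (g.toTerm p) (f.toTerm p)
  | _, .and f g => .and (f.toTerm p) (g.toTerm p)

theorem PTerm.skel_toTerm {L : Type u} (p : L) :
    ∀ {n : ℕ} (f : PTerm n), (f.toTerm p).skel = f.skel
  | _, .id _ => rfl
  | _, .cm _ => rfl
  | _, .comp g f => congrArg₂ Skel.comp (g.skel_toTerm p) (f.skel_toTerm p)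
  | _, .and f g => congrArg₂ Skel.and (f.skel_toTerm p) (g.skel_toTerm p)

/-- The functor from `C^m(p^n)` to `C^m`, as a homomorphism to the endomorphisms of `p^n`. -/
def PHom.toEnd {L : Type u} (p : L) (n : ℕ) : PHom n →* End (Form.pow p n) where
  toFun := Quotient.map (PTerm.toTerm p) fun f g h =>
    CEq.of_pterm h (f.skel_toTerm p) (g.skel_toTerm p)
  map_one' := rfl
  map_mul' := by
    rintro ⟨g⟩ ⟨f⟩
    rfl

/-! ### The functor `G` -/

/-- Finite ordinals. -/
structure FinOrdinal : Type where
  card : ℕ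

/-- The category whose objects are finite ordinals and whose arrows are permutations: the arrows
`m → n` are the bijections, so there are none for `m ≠ n`. -/
instance instCategoryFinOrdinal : Category FinOrdinal where
  Hom m n := Fin m.card ≃ Fin n.card
  id m := Equiv.refl (Fin m.card)
  comp f g := Equiv.trans f g

/-- The permutation denoted by an arrow term: places in the source are mapped to places in the
target. -/
def Term.graph {L : Type u} : {A B : Form L} → Term A B → (Fin A.len ≃ Fin B.len)
  | _, _, .id A => Equiv.refl (Fin A.len)
  | _, _, .cm A B C D =>
    ((finSumFinEquiv.symm.trans (Equiv.sumCongr finSumFinEquiv.symm finSumFinEquiv.symm)).trans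
      (Equiv.sumSumSumComm (Fin A.len) (Fin B.len) (Fin C.len) (Fin D.len))).trans
      ((Equiv.sumCongr finSumFinEquiv finSumFinEquiv).trans finSumFinEquiv)
  | _, _, .comp g f => f.graph.trans g.graph
  | _, _, .and f g =>
    finSumFinEquiv.symm.trans ((Equiv.sumCongr f.graph g.graph).trans finSumFinEquiv)

/-- The equations of `C^m` hold for the associated permutations. -/
def GraphSound (L : Type u) : Prop :=
  ∀ (A B : Form L) (f g : Term A B), CEq f g → f.graph = g.graph

/-- The functor `G`, which is well defined on arrows because of `h`. -/
def functorG {L : Type u} (h : GraphSound L) : Form L ⥤ FinOrdinal where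
  obj A := ⟨A.len⟩
  map {A B} f := Quotient.lift (s := cSetoid A B) Term.graph (fun f g hfg => h A B f g hfg) f
  map_id _ := rfl
  map_comp := by
    rintro A B C ⟨f⟩ ⟨g⟩
    rfl

end MedialComm

namespace MedialComm

universe u

/-! Arrow terms of `C^m(p^n)` act on the leaves of the complete binary tree of height `n`, that is,
on words of `n` left and right turns: `c^m` interchanges the first two turns and `∧` acts on the two
halves separately. The number of right turns, the weight, is preserved, and `n.choose i` leaves have
weight `i`. When these are listed from left to right, `i_{j,j+1}` acts as the transposition of the
`j`-th and the next one (`perm_tr`), and all equations hold for the action (`PEq.perm_eq`).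

Conversely, (def c^m) makes the `i_{j,j+1}` generate the group (`iSup_subG`), and (norm) makes
different `G_i` commute. Inside one `G_i`, the equations (YB), (perm) and `c^m ∘ c^m = 1` give the
Coxeter relations of a symmetric group, so `G_i` acts faithfully (`eq_one_of_acts_trivially`). Since
`G_i` moves only leaves of weight `i`, the `G_i` are independent, the product is direct, and the
whole group acts faithfully (`permHom_injective`). Hence equality in `C^m(p^n)` is equality of
permutations (`PEq.of_perm_eq`), and `G_i` is the full symmetric group on the leaves of weight `i`.

For `C^m`, a skeleton acts on words regardless of the indices deleted. It rewrites an initial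
segment of a word and leaves the rest alone, so the permutation of the letters of `A` and the
permutation of the leaves of a tree at least as high as `A` determine each other
(`graph_eq_of_perm_eq`, `perm_eq_of_graph_eq`). Every arrow term shares its skeleton with a term of
some `C^m(p^n)` (`Term.exists_pterm`), and this transfers completeness to `C^m`. -/

/-! ### Leaves of the complete binary tree -/

/-- The leaves of the complete binary tree of height `n`. -/
def Leaf : ℕ → Type
  | 0 => Unit
  | n + 1 => Leaf n ⊕ Leaf n

instance Leaf.instDecidableEq : (n : ℕ) → DecidableEq (Leaf n)
  | 0 => inferInstanceAs (DecidableEq Unit)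
  | n + 1 =>
    letI := Leaf.instDecidableEq n
    inferInstanceAs (DecidableEq (Leaf n ⊕ Leaf n))

/-- The number of right turns on the path from the root to a leaf. -/
def Leaf.weight : {n : ℕ} → Leaf n → ℕ
  | 0, _ => 0
  | _ + 1, Sum.inl x => x.weight
  | _ + 1, Sum.inr x => x.weight + 1

/-- The place, counted from `0`, of a leaf among the leaves of the same weight. -/
def Leaf.rank : {n : ℕ} → Leaf n → ℕ
  | 0, _ => 0
  | _ + 1, Sum.inl x => x.rank
  | n + 1, Sum.inr x => n.choose (x.weight + 1) + x.rank

/-- The leaf of weight `i` and rank `j`. -/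
def unrank : (n i j : ℕ) → Leaf n
  | 0, _, _ => ()
  | n + 1, i, j =>
    if j < n.choose i then Sum.inl (unrank n i j)
    else Sum.inr (unrank n (i - 1) (j - n.choose i))

theorem unrank_inl {n i j : ℕ} (h : j < n.choose i) :
    unrank (n + 1) i j = Sum.inl (unrank n i j) :=
  if_pos h

theorem unrank_inr (n i j : ℕ) :
    unrank (n + 1) (i + 1) (n.choose (i + 1) + j) = Sum.inr (unrank n i j) := by
  refine (if_neg (by omega)).trans ?_
  rw [Nat.add_sub_cancel_left, Nat.add_sub_cancel]

theorem unrank_weight_rank : ∀ {n : ℕ} (x : Leaf n), unrank n x.weight x.rank = x ∧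
    x.rank < n.choose x.weight
  | 0, _ => ⟨rfl, by simp [Leaf.weight, Leaf.rank]⟩
  | n + 1, Sum.inl x => by
    obtain ⟨h1, h2⟩ := unrank_weight_rank x
    refine ⟨?_, ?_⟩
    · change unrank (n + 1) x.weight x.rank = _
      rw [unrank_inl h2, h1]
    · change x.rank < (n + 1).choose x.weight
      exact h2.trans_le (Nat.choose_le_choose _ (Nat.le_succ n))
  | n + 1, Sum.inr x => by
    obtain ⟨h1, h2⟩ := unrank_weight_rank x
    refine ⟨?_, ?_⟩
    · change unrank (n + 1) (x.weight + 1) (n.choose (x.weight + 1) + x.rank) = _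
      rw [unrank_inr, h1]
    · change n.choose (x.weight + 1) + x.rank < (n + 1).choose (x.weight + 1)
      rw [Nat.choose_succ_succ' n]
      omega

theorem weight_rank_unrank : ∀ {n i j : ℕ}, j < n.choose i →
    (unrank n i j).weight = i ∧ (unrank n i j).rank = j
  | 0, 0, j, h => by
    simp only [Nat.choose_self, Nat.lt_one_iff] at h
    subst h
    exact ⟨rfl, rfl⟩
  | 0, i + 1, j, h => by simp at h
  | n + 1, 0, j, h => by
    have h' : j < n.choose 0 := by simpa using h
    rw [unrank_inl h']
    exact weight_rank_unrank h'
  | n + 1, i + 1, j, h => by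
    by_cases h' : j < n.choose (i + 1)
    · rw [unrank_inl h']
      exact weight_rank_unrank h'
    · obtain ⟨k, rfl⟩ := Nat.exists_eq_add_of_le (not_lt.mp h')
      rw [Nat.choose_succ_succ' n] at h
      obtain ⟨h1, h2⟩ := weight_rank_unrank (n := n) (i := i) (j := k) (by omega)
      rw [unrank_inr]
      refine ⟨congrArg (· + 1) h1, ?_⟩
      change n.choose ((unrank n i k).weight + 1) + (unrank n i k).rank = _
      rw [h1, h2]

theorem unrank_injOn (n i : ℕ) : Set.InjOn (unrank n i) {j | j < n.choose i} := by
  intro j hj k hk h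
  rw [← (weight_rank_unrank hj).2, h, (weight_rank_unrank hk).2]

theorem unrank_ne {n i j k : ℕ} (hj : j < n.choose i) (hk : k < n.choose i) (h : j ≠ k) :
    unrank n i j ≠ unrank n i k :=
  fun e => h (unrank_injOn n i hj hk e)

theorem Leaf.weight_le {n : ℕ} (x : Leaf n) : x.weight ≤ n := by
  by_contra h
  have := (unrank_weight_rank x).2
  rw [Nat.choose_eq_zero_of_lt (not_le.mp h)] at this
  omega

/-! ### The permutation of the leaves denoted by an arrow term of `C^m(p^n)` -/

/-- The permutation of the leaves of the complete binary tree denoted by an arrow term. -/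
def PTerm.perm : {n : ℕ} → PTerm n → Equiv.Perm (Leaf n)
  | _, .id _ => 1
  | _, .cm n => Equiv.sumSumSumComm (Leaf n) (Leaf n) (Leaf n) (Leaf n)
  | _, .comp g f => g.perm * f.perm
  | _, .and f g => Equiv.Perm.sumCongr f.perm g.perm

theorem PTerm.perm_comp {n : ℕ} (g f : PTerm n) : (PTerm.comp g f).perm = g.perm * f.perm := rfl

/-- For `i = 0` and `i = n` the binomial coefficient is `1`, which leaves no room for `j`. -/
theorem valid_iff {n i j : ℕ} (h : i ≤ n) : Valid n i j ↔ 1 ≤ j ∧ j + 1 ≤ n.choose i := by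
  refine ⟨fun h => h.2.2, fun ⟨h1, h2⟩ => ⟨?_, ?_, h1, h2⟩⟩
  · rcases Nat.eq_zero_or_pos i with rfl | h'
    · rw [Nat.choose_zero_right] at h2
      omega
    · exact h'
  · rcases h.eq_or_lt with rfl | h'
    · rw [Nat.choose_self] at h2
      omega
    · exact h'

/-! ### The transpositions denoted by the terms `i_{j,j+1}` -/

theorem swap_mul_swap_mul_swap_of_ne {α : Type*} [DecidableEq α] {x y z : α} (hxz : x ≠ z)
    (hyz : y ≠ z) : Equiv.swap x y * (Equiv.swap y z * Equiv.swap x y) = Equiv.swap x z := by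
  rw [← mul_assoc, Equiv.swap_comm x y, Equiv.swap_comm y z,
    Equiv.swap_mul_swap_mul_swap hyz.symm hxz.symm]

/-- Each outer layer conjugates a transposition by a neighbouring one. Terms are numbered from `1`
and leaves from `0`. The sequence `s` is left general because `trHalf` is needed inside the
induction on the height and `tr` after it. -/
theorem perm_swapAux {n : ℕ} {s : ℕ → PTerm n} {e : ℕ → Leaf n} : ∀ (d j : ℕ),
    (∀ l, j ≤ l → l ≤ j + d → (s (l + 1)).perm = Equiv.swap (e l) (e (l + 1))) →
    Set.InjOn e {l | j ≤ l ∧ l ≤ j + d + 1} →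
    (swapAux s d (j + 1)).perm = Equiv.swap (e j) (e (j + d + 1))
  | 0, j, h, _ => h j le_rfl le_rfl
  | d + 1, j, h, he => by
    have h1 := h j le_rfl (by omega)
    have h2 := perm_swapAux (s := s) (e := e) d (j + 1)
      (fun l hl hl' => h l (by omega) (by omega))
      (he.mono fun l (hl : _ ∧ _) => (⟨by omega, by omega⟩ : _ ∧ _))
    simp only [swapAux, PTerm.perm, h1, h2]
    rw [show j + 1 + d + 1 = j + (d + 1) + 1 by omega]
    apply swap_mul_swap_mul_swap_of_ne
    · exact fun e => absurd (he ⟨le_rfl, by omega⟩ ⟨by omega, by omega⟩ e) (by omega)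
    · exact fun e => absurd (he ⟨by omega, by omega⟩ ⟨by omega, by omega⟩ e) (by omega)

/-- Conjugating by `g` turns the transposition of `x` and `y` into that of `x` and `g y`;
conjugating the result by the original transposition replaces `x` by `y`. This is the pattern `α ∘ γ
∘ α ∘ γ ∘ α`. -/
theorem swap_mul_conj_swap {α : Type*} [DecidableEq α] {g : Equiv.Perm α} (hg : g * g = 1)
    {x y : α} (hxy : x ≠ y) (hx : g x = x) (hy : g y ≠ y) :
    Equiv.swap x y * (g * (Equiv.swap x y * (g * Equiv.swap x y))) = Equiv.swap y (g y) := by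
  have hxy' : x ≠ g y := fun e => hxy (g.injective (hx.trans e))
  have h : g * (Equiv.swap x y * (g * Equiv.swap x y)) = Equiv.swap x (g y) * Equiv.swap x y := by
    rw [← mul_assoc, ← mul_assoc, Equiv.mul_swap_eq_swap_mul g x y, hx, mul_assoc _ g g, hg, mul_one]
  rw [h, Equiv.swap_comm x y]
  exact swap_mul_swap_mul_swap_of_ne hy.symm hxy'

theorem perm_cm_mul_perm_cm (n : ℕ) : (PTerm.cm n).perm * (PTerm.cm n).perm = 1 := by
  ext ((x | x) | (x | x)) <;> rfl

theorem unrank_inl_inl {n i j : ℕ} (h : j < n.choose i) :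
    unrank (n + 2) i j = Sum.inl (Sum.inl (unrank n i j)) :=
  (unrank_inl (h.trans_le (Nat.choose_le_choose _ (Nat.le_succ n)))).trans
    (congrArg Sum.inl (unrank_inl h))

theorem unrank_inl_inr {n i j : ℕ} (h : j < n.choose i) :
    unrank (n + 2) (i + 1) (n.choose (i + 1) + j) = Sum.inl (Sum.inr (unrank n i j)) :=
  (unrank_inl (by rw [Nat.choose_succ_succ' n]; omega)).trans (congrArg Sum.inl (unrank_inr n i j))

theorem unrank_inr_inl {n i j : ℕ} (h : j < n.choose i) :
    unrank (n + 2) (i + 1) ((n + 1).choose (i + 1) + j) = Sum.inr (Sum.inl (unrank n i j)) :=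
  (unrank_inr _ _ _).trans (congrArg Sum.inr (unrank_inl h))

theorem unrank_inr_inr (n i j : ℕ) :
    unrank (n + 2) (i + 2) ((n + 1).choose (i + 2) + (n.choose (i + 1) + j)) =
      Sum.inr (Sum.inr (unrank n i j)) :=
  (unrank_inr _ _ _).trans (congrArg Sum.inr (unrank_inr _ _ _))

/-- The terms `i_{l,l+1}^{n+3}` with `l ≠ (n+2 choose i)`, which act on one half of the tree. -/
def trHalf (n i l : ℕ) : PTerm (n + 3) :=
  if l < (n + 2).choose i then .and (tr (n + 2) i l) (.id (n + 2))
  else .and (.id (n + 2)) (tr (n + 2) (i - 1) (l - (n + 2).choose i))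

theorem tr_of_ne {n i j : ℕ} (h : j ≠ (n + 2).choose i) : tr (n + 3) i j = trHalf n i j :=
  if_pos h

theorem tr_choose (n i : ℕ) : tr (n + 3) i ((n + 2).choose i) =
    let γ : PTerm (n + 3) := .cm (n + 1)
    let α := trHalf n i ((n + 1).choose i)
    let β := swap (trHalf n i) ((n + 1).choose i + 1) ((n + 2).choose i)
    if i = 1 then .comp α (.comp γ (.comp α (.comp γ α)))
    else if i = n + 2 then
      .comp (trHalf n i 2) (.comp γ (.comp (trHalf n i 2) (.comp γ (trHalf n i 2))))
    else .comp β (.comp α (.comp γ (.comp α (.comp γ (.comp α β))))) :=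
  if_neg (not_not.mpr rfl)

/-- In height `n`, the terms `i_{j,j+1}` denote transpositions of neighbours among the leaves of
weight `i`. -/
def TrSwaps (n : ℕ) : Prop :=
  ∀ i j, Valid n i (j + 1) → (tr n i (j + 1)).perm = Equiv.swap (unrank n i j) (unrank n i (j + 1))

theorem perm_trHalf {n i l : ℕ} (ih : TrSwaps (n + 2)) (h : Valid (n + 3) i (l + 1))
    (hl : l + 1 ≠ (n + 2).choose i) :
    (trHalf n i (l + 1)).perm = Equiv.swap (unrank (n + 3) i l) (unrank (n + 3) i (l + 1)) := by
  obtain ⟨h1, h2, -, h4⟩ := h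
  obtain ⟨i, rfl⟩ := Nat.exists_eq_add_of_le' h1
  rw [Nat.choose_succ_succ' (n + 2)] at h4
  rcases lt_or_gt_of_ne hl with hl | hl
  · rw [trHalf, if_pos hl, unrank_inl hl, unrank_inl (by omega), PTerm.perm,
      ih _ _ ((valid_iff (by omega)).mpr ⟨by omega, by omega⟩)]
    exact Equiv.Perm.sumCongr_swap_one _ _
  · obtain ⟨k, rfl⟩ := Nat.exists_eq_add_of_le (Nat.lt_succ_iff.mp hl)
    rw [trHalf, if_neg (by omega), unrank_inr, add_assoc, unrank_inr, PTerm.perm,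
      Nat.add_sub_cancel_left, Nat.add_sub_cancel,
      ih _ _ ((valid_iff (by omega)).mpr ⟨by omega, by omega⟩)]
    exact Equiv.Perm.sumCongr_one_swap _ _

theorem perm_cm_unrank {n i j : ℕ} (h : j < n.choose i) :
    (PTerm.cm n).perm (unrank (n + 2) (i + 1) (n.choose (i + 1) + j)) =
      unrank (n + 2) (i + 1) ((n + 1).choose (i + 1) + j) := by
  rw [unrank_inl_inr h, unrank_inr_inl h]
  rfl

/-- This generator alone crosses from the left half to the right half. Call the quarters of the tree
LL, LR, RL, RR; `γ` interchanges LR with RL and fixes the leaves of LL and RR. The last leaf of the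
given weight in LR has to be exchanged with the first one in RL. -/
theorem perm_tr_choose {n i : ℕ} (ih : TrSwaps (n + 2)) (hi : 1 ≤ i) (hi' : i ≤ n + 2) {j : ℕ}
    (hj : j + 1 = (n + 2).choose i) :
    (tr (n + 3) i (j + 1)).perm =
      Equiv.swap (unrank (n + 3) i j) (unrank (n + 3) i (j + 1)) := by
  obtain ⟨i, rfl⟩ := Nat.exists_eq_add_of_le' hi
  have hhalf : ∀ l, l + 2 ≤ (n + 3).choose (i + 1) → l + 1 ≠ (n + 2).choose (i + 1) →
      (trHalf n (i + 1) (l + 1)).perm =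
        Equiv.swap (unrank (n + 3) (i + 1) l) (unrank (n + 3) (i + 1) (l + 1)) :=
    fun l h h' => perm_trHalf ih ((valid_iff (by omega)).mpr ⟨by omega, h⟩) h'
  have hb : (n + 2).choose (i + 1) = (n + 1).choose i + (n + 1).choose (i + 1) :=
    Nat.choose_succ_succ' (n + 1) i
  have hc : (n + 3).choose (i + 1) = (n + 2).choose i + (n + 2).choose (i + 1) :=
    Nat.choose_succ_succ' (n + 2) i
  have hd : 0 < (n + 1).choose i := Nat.choose_pos (by omega)
  have hd' : (n + 1).choose i ≤ (n + 2).choose i := Nat.choose_le_choose _ (Nat.le_succ _)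
  have hγ := perm_cm_mul_perm_cm (n + 1)
  have hγa : (PTerm.cm (n + 1)).perm (unrank (n + 3) (i + 1) ((n + 1).choose (i + 1))) =
      unrank (n + 3) (i + 1) ((n + 2).choose (i + 1)) :=
    perm_cm_unrank (n := n + 1) (i := i) (j := 0) hd
  -- `α` exchanges the last leaf of this weight in LL, fixed by `γ`, with the first one in LR, which
  -- `γ` carries to the first one in RL. The bound on `i` ensures that LL has such a leaf.
  have hα : i ≤ n → (PTerm.comp (trHalf n (i + 1) ((n + 1).choose (i + 1))) (.comp (.cm (n + 1))
      (.comp (trHalf n (i + 1) ((n + 1).choose (i + 1))) (.comp (.cm (n + 1))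
      (trHalf n (i + 1) ((n + 1).choose (i + 1))))))).perm =
      Equiv.swap (unrank (n + 3) (i + 1) ((n + 1).choose (i + 1)))
        (unrank (n + 3) (i + 1) ((n + 2).choose (i + 1))) := by
    intro hin
    have ha : 0 < (n + 1).choose (i + 1) := Nat.choose_pos (by omega)
    obtain ⟨a, ha'⟩ := Nat.exists_eq_add_of_le' ha
    have := hhalf a (by omega) (by omega)
    rw [← ha'] at this
    simp only [PTerm.perm_comp]
    rw [this, swap_mul_conj_swap hγ, hγa]
    · exact unrank_ne (by omega) (by omega) (by omega)
    · rw [unrank_inl_inl (by omega)]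
      rfl
    · rw [hγa]
      exact unrank_ne (by omega) (by omega) (by omega)
  rw [hj, tr_choose]
  -- LR then has a single leaf of this weight, so its first one is already its last.
  by_cases h1 : i = 0
  · subst h1
    rw [Nat.choose_zero_right] at hb
    have hja : j = (n + 1).choose (0 + 1) := by omega
    subst hja
    exact hα (by omega)
  -- LL has no leaf of this weight, so the leaf fixed by `γ` is taken from RR: ranks `0`, `1`, `2`
  -- lie in LR, RL, RR.
  by_cases h2 : i = n + 1
  · subst h2
    have h01 : j = 0 := by
      rw [Nat.choose_self] at hj
      omega
    subst h01
    have e2 : unrank (n + 3) (n + 2) 2 = Sum.inr (Sum.inr (unrank (n + 1) n 0)) := by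
      simpa using unrank_inr_inr (n + 1) n 0
    have hs := hhalf 1 (by rw [Nat.choose_succ_self_right]; omega) (by rw [Nat.choose_self]; omega)
    simp only [Nat.choose_self, Nat.choose_succ_self, add_assoc, Nat.reduceAdd] at hs hγa ⊢
    have hγ1 : (PTerm.cm (n + 1)).perm (unrank (n + 3) (n + 2) 1) = unrank (n + 3) (n + 2) 0 := by
      rw [← hγa, ← Equiv.Perm.mul_apply, hγ, Equiv.Perm.one_apply]
    have hlt : 2 < (n + 3).choose (n + 2) := by
      rw [Nat.choose_succ_self_right]
      omega
    rw [if_neg (by omega), if_pos trivial]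
    simp only [PTerm.perm_comp]
    rw [hs, Equiv.swap_comm, swap_mul_conj_swap hγ, hγ1, Equiv.swap_comm]
    · exact unrank_ne hlt (by omega) (by omega)
    · rw [e2]
      rfl
    · rw [hγ1]
      exact unrank_ne (by omega) (by omega) (by omega)
  -- The first and the last leaf of this weight in LR now differ; `β` exchanges them, and
  -- conjugation by it replaces the first by the last.
  · have hd2 : 2 ≤ (n + 1).choose i := by
      obtain ⟨k, rfl⟩ : ∃ k, i = k + 1 := ⟨i - 1, by omega⟩
      have := Nat.choose_succ_succ' n k
      have := Nat.choose_pos (n := n) (k := k) (by omega)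
      have := Nat.choose_pos (n := n) (k := k + 1) (by omega)
      omega
    have hβ := perm_swapAux (s := trHalf n (i + 1)) (e := unrank (n + 3) (i + 1))
      ((n + 2).choose (i + 1) - ((n + 1).choose (i + 1) + 1) - 1) ((n + 1).choose (i + 1))
      (fun l _ _ => hhalf l (by omega) (by omega))
      ((unrank_injOn _ _).mono fun l hl => by
        have := hl.2
        change l < _
        omega)
    rw [show (n + 1).choose (i + 1) + ((n + 2).choose (i + 1) - ((n + 1).choose (i + 1) + 1) - 1) + 1
      = j by omega, ← swap] at hβ
    have hα := hα (by omega)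
    simp only [PTerm.perm_comp] at hα
    simp only [show ¬ i + 1 = 1 by omega, show ¬ i + 1 = n + 2 by omega, if_false, PTerm.perm_comp]
    rw [hβ, ← mul_assoc _ _ (Equiv.swap _ _), ← mul_assoc _ _ (Equiv.swap _ _),
      ← mul_assoc _ _ (Equiv.swap _ _), ← mul_assoc _ _ (Equiv.swap _ _), hα, Equiv.swap_comm]
    exact swap_mul_swap_mul_swap_of_ne (unrank_ne (by omega) (by omega) (by omega))
      (unrank_ne (by omega) (by omega) (by omega))

theorem perm_tr : ∀ n, TrSwaps n
  | 0 => fun i j h => by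
    have := h.2.1
    omega
  | 1 => fun i j h => by
    have := h.1
    have := h.2.1
    omega
  | 2 => fun i j h => by
    obtain ⟨h1, h2, -, h4⟩ := h
    obtain rfl : i = 1 := by omega
    obtain rfl : j = 0 := by
      simp at h4
      omega
    ext x
    revert x
    rintro ((⟨⟩ | ⟨⟩) | (⟨⟩ | ⟨⟩)) <;> rfl
  | n + 3 => fun i j h => by
    by_cases hj : j + 1 = (n + 2).choose i
    · exact perm_tr_choose (perm_tr (n + 2)) h.1 (by have := h.2.1; omega) hj
    · rw [tr_of_ne hj]
      exact perm_trHalf (perm_tr (n + 2)) h hj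

/-! ### The permutation denoted by the right-hand side of (def c^m) -/

open Classical in
/-- The permutation that interchanges the two middle copies of each element of `S`. -/
noncomputable def medialOn {α : Type*} (S : Set α) : Equiv.Perm ((α ⊕ α) ⊕ (α ⊕ α)) :=
  Function.Involutive.toPerm
    (fun
      | .inl (.inr x) => if x ∈ S then .inr (.inl x) else .inl (.inr x)
      | .inr (.inl x) => if x ∈ S then .inl (.inr x) else .inr (.inl x)
      | z => z)
    (by rintro ((x | x) | (x | x)) <;> by_cases h : x ∈ S <;> simp [h])

open Classical in
theorem medialOn_apply {α : Type*} (S : Set α) (z : (α ⊕ α) ⊕ (α ⊕ α)) :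
    medialOn S z = match z with
      | .inl (.inr x) => if x ∈ S then .inr (.inl x) else .inl (.inr x)
      | .inr (.inl x) => if x ∈ S then .inl (.inr x) else .inr (.inl x)
      | z => z := by
  rcases z with ((x | x) | (x | x)) <;> rfl

theorem medialOn_empty {α : Type*} : medialOn (∅ : Set α) = 1 := by
  classical
  ext ((x | x) | (x | x)) <;> simp [medialOn_apply]

theorem medialOn_univ {α : Type*} : medialOn (Set.univ : Set α) = Equiv.sumSumSumComm α α α α := by
  classical
  ext ((x | x) | (x | x)) <;> simp [medialOn_apply]

theorem medialOn_mul {α : Type*} {S T : Set α} (h : Disjoint S T) :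
    medialOn S * medialOn T = medialOn (S ∪ T) := by
  classical
  have h' : ∀ x ∈ T, x ∉ S := fun x hT hS => Set.disjoint_left.mp h hS hT
  ext ((x | x) | (x | x)) <;> by_cases hT : x ∈ T <;>
    simp [medialOn_apply, hT, h']

theorem medialOn_singleton {α : Type*} [DecidableEq α] (x : α) :
    medialOn {x} = Equiv.swap (Sum.inl (Sum.inr x)) (Sum.inr (Sum.inl x)) := by
  classical
  ext ((y | y) | (y | y)) <;> by_cases h : y = x <;>
    simp [medialOn_apply, h, Equiv.swap_apply_def]

theorem perm_prodUpTo {n : ℕ} {f : ℕ → PTerm (n + 2)} {S : ℕ → Set (Leaf n)} : ∀ k : ℕ,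
    (∀ t, t < k → (f (t + 1)).perm = medialOn (S t)) →
    (∀ s t, s < t → t < k → Disjoint (S s) (S t)) →
    (prodUpTo f k).perm = medialOn {x | ∃ t < k, x ∈ S t}
  | 0, _, _ => by
    simp only [not_lt_zero, false_and, exists_false]
    exact medialOn_empty.symm
  | k + 1, hf, hS => by
    rw [prodUpTo, PTerm.perm_comp, hf k (Nat.lt_succ_self k),
      perm_prodUpTo k (fun t ht => hf t (by omega)) (fun s t hst ht => hS s t hst (by omega))]
    refine (medialOn_mul ?_).trans (congrArg medialOn ?_)
    · rw [Set.disjoint_left]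
      rintro x ⟨t, ht, hx⟩ hx'
      exact Set.disjoint_left.mp (hS t k ht (Nat.lt_succ_self k)) hx hx'
    · ext x
      simp only [Set.mem_union, Set.mem_ofPred_eq, Nat.lt_succ_iff_lt_or_eq]
      constructor
      · rintro (⟨t, ht, hx⟩ | hx)
        exacts [⟨t, Or.inl ht, hx⟩, ⟨k, Or.inr rfl, hx⟩]
      · rintro ⟨t, ht | rfl, hx⟩
        exacts [Or.inl ⟨t, ht, hx⟩, Or.inr hx]

theorem perm_swap_tr {n i j k : ℕ} (hi : i ≤ n) (hjk : j < k) (hk : k < n.choose i) :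
    (swap (tr n i) (j + 1) (k + 1)).perm = Equiv.swap (unrank n i j) (unrank n i k) := by
  have := perm_swapAux (s := tr n i) (e := unrank n i) (k + 1 - (j + 1) - 1) j
    (fun l _ _ => perm_tr n i l ((valid_iff hi).mpr ⟨by omega, by omega⟩))
    ((unrank_injOn n i).mono fun l hl => by
      have := hl.2
      change l < _
      omega)
  rwa [show j + (k + 1 - (j + 1) - 1) + 1 = k by omega] at this

/-- The medial permutation is the product of disjoint transpositions, one for each leaf `x` of a
quarter, exchanging the copies of `x` in LR and RL. The outer product sorts them by the weight of
`x`, the inner one by its rank. -/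
theorem perm_cmProd (n : ℕ) : (cmProd (n + 2)).perm = (PTerm.cm (n + 1)).perm := by
  refine (perm_prodUpTo (S := fun i => {x | x.weight = i}) (n + 2) ?_ ?_).trans ?_
  · intro i hi
    refine (perm_prodUpTo (S := fun t => {unrank (n + 1) i t}) ((n + 1).choose i) ?_ ?_).trans
      (congrArg medialOn ?_)
    · intro t ht
      have hb : (n + 2).choose (i + 1) = (n + 1).choose i + (n + 1).choose (i + 1) :=
        Nat.choose_succ_succ' (n + 1) i
      have hc : (n + 3).choose (i + 1) = (n + 2).choose i + (n + 2).choose (i + 1) :=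
        Nat.choose_succ_succ' (n + 2) i
      have hd' : (n + 1).choose i ≤ (n + 2).choose i := Nat.choose_le_choose _ (Nat.le_succ _)
      -- These two ranks belong to the `t`-th leaf of LR and the `t`-th leaf of RL. A right turn
      -- precedes each, so weight `i + 1` in the tree is weight `i` in the quarter.
      refine (perm_swap_tr (n := n + 3) (i := i + 1) (j := (n + 1).choose (i + 1) + t)
        (k := (n + 2).choose (i + 1) + t) (by omega) (by omega) (by omega)).trans ?_
      rw [unrank_inl_inr ht, unrank_inr_inl ht]
      exact (medialOn_singleton _).symm
    · intro s t hst ht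
      rw [Set.disjoint_singleton]
      exact unrank_ne (hst.trans ht) ht hst.ne
    · ext x
      simp only [Set.mem_singleton_iff, Set.mem_ofPred_eq]
      constructor
      · rintro ⟨t, ht, rfl⟩
        exact (weight_rank_unrank ht).1
      · rintro rfl
        exact ⟨x.rank, (unrank_weight_rank x).2, (unrank_weight_rank x).1.symm⟩
  · intro s t hst _
    rw [Set.disjoint_left]
    intro x (hx : x.weight = s) (hx' : x.weight = t)
    omega
  · refine Eq.trans (congrArg medialOn ?_) medialOn_univ
    ext x
    simp only [Set.mem_ofPred_eq, Set.mem_univ, iff_true]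
    exact ⟨x.weight, Nat.lt_succ_of_le x.weight_le, rfl⟩

/-! ### Soundness of the equations of `C^m(p^n)` for the action on leaves -/

/-- The transpositions are disjoint: weight and rank determine a leaf, and the fourth inequality
needed is equivalent to the first. This serves both (norm) and (perm). -/
theorem swap_unrank_commute {n i j k l : ℕ} (hij : (i, j) ≠ (k, l)) (hij' : (i, j + 1) ≠ (k, l))
    (hij'' : (i, j) ≠ (k, l + 1)) (hj : j + 1 < n.choose i) (hl : l + 1 < n.choose k) :
    Equiv.swap (unrank n i j) (unrank n i (j + 1)) * Equiv.swap (unrank n k l) (unrank n k (l + 1)) =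
    Equiv.swap (unrank n k l) (unrank n k (l + 1)) *
      Equiv.swap (unrank n i j) (unrank n i (j + 1)) := by
  have key : ∀ {a b : ℕ}, a < n.choose i → b < n.choose k → (i, a) ≠ (k, b) →
      unrank n i a ≠ unrank n k b := by
    intro a b ha hb hne e
    apply hne
    rw [Prod.mk.injEq, ← (weight_rank_unrank ha).1, ← (weight_rank_unrank hb).1, e]
    refine ⟨rfl, ?_⟩
    rw [← (weight_rank_unrank ha).2, e, (weight_rank_unrank hb).2]
  refine (Equiv.Perm.disjoint_swap_swap ?_).commute.eq
  simp only [List.nodup_cons, List.mem_cons, List.not_mem_nil, or_false, not_or, not_false_eq_true,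
    List.nodup_nil, and_true]
  refine ⟨⟨unrank_ne (by omega) hj (by omega), key (by omega) (by omega) hij,
    key (by omega) hl hij''⟩, ⟨key hj (by omega) hij', key hj hl (by simpa using hij)⟩,
    unrank_ne (by omega) hl (by omega)⟩

theorem PEq.perm_eq {n : ℕ} {u v : PTerm n} (h : PEq u v) : u.perm = v.perm := by
  induction h with
  | refl => rfl
  | symm _ ih => exact ih.symm
  | trans _ _ ih ih' => exact ih.trans ih'
  | comp_congr _ _ ih ih' => rw [PTerm.perm_comp, PTerm.perm_comp, ih, ih']
  | and_congr _ _ ih ih' => rw [PTerm.perm, PTerm.perm, ih, ih']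
  | comp_id | id_comp | assoc => rfl
  | bif1 => exact Equiv.Perm.sumCongr_one
  | bif2 => exact (Equiv.Perm.sumCongr_mul _ _ _ _).symm
  | cm_nat => ext ((x | x) | (x | x)) <;> rfl
  | cm_cm n => exact perm_cm_mul_perm_cm n
  | @norm n i j k l _ hij hk hl =>
    obtain ⟨k, rfl⟩ := Nat.exists_eq_add_of_le' hk.2.2.1
    obtain ⟨l, rfl⟩ := Nat.exists_eq_add_of_le' hl.2.2.1
    rw [PTerm.perm_comp, PTerm.perm_comp, perm_tr _ _ _ hk, perm_tr _ _ _ hl]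
    exact swap_unrank_commute (by simp [hij]) (by simp [hij]) (by simp [hij]) hk.2.2.2 hl.2.2.2
  | @yb n i j _ hj hj' =>
    obtain ⟨j, rfl⟩ := Nat.exists_eq_add_of_le' hj.2.2.1
    have h1 := hj'.2.2.2
    have h01 : unrank n i j ≠ unrank n i (j + 1) := unrank_ne (by omega) (by omega) (by omega)
    have h02 : unrank n i j ≠ unrank n i (j + 2) := unrank_ne (by omega) (by omega) (by omega)
    have h12 : unrank n i (j + 1) ≠ unrank n i (j + 2) := unrank_ne (by omega) (by omega) (by omega)
    -- Both sides are the transposition of the two outer leaves.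
    simp only [PTerm.perm_comp]
    rw [perm_tr _ _ _ hj, perm_tr _ _ _ hj', swap_mul_swap_mul_swap_of_ne h02 h12,
      Equiv.swap_comm (unrank n i (j + 1)), Equiv.swap_comm (unrank n i j) (unrank n i (j + 1)),
      Equiv.swap_comm (unrank n i j)]
    exact (swap_mul_swap_mul_swap_of_ne h02.symm h01.symm).symm
  | def_cm n => exact (perm_cmProd n).symm
  | @perm n i j k _ hk hj hj' =>
    obtain ⟨j, rfl⟩ := Nat.exists_eq_add_of_le' hj.2.2.1
    have e : j + 1 + k = j + k + 1 := by omega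
    rw [e] at hj' ⊢
    rw [PTerm.perm_comp, PTerm.perm_comp, perm_tr _ _ _ hj, perm_tr _ _ _ hj']
    exact swap_unrank_commute (by simp; omega) (by simp; omega) (by simp; omega)
      hj.2.2.2 hj'.2.2.2

/-- The action of the group `C^m(p^n)` on the leaves of the complete binary tree. -/
def PHom.permHom (n : ℕ) : PHom n →* Equiv.Perm (Leaf n) where
  toFun := Quotient.lift PTerm.perm fun _ _ h => h.perm_eq
  map_one' := rfl
  map_mul' := by
    rintro ⟨g⟩ ⟨f⟩
    rfl

/-! ### Groups with the defining relations of the symmetric groups -/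

section Coxeter

variable {G : Type*} [Group G] {s : ℕ → G} {N : ℕ}

/-- The product `s (j + d - 1) * ⋯ * s (j + 1) * s j`. -/
def descProd (s : ℕ → G) : ℕ → ℕ → G
  | _, 0 => 1
  | j, d + 1 => descProd s (j + 1) d * s j

/-- The defining relations of the symmetric group on `N` letters, for the images `s 0, …, s (N - 2)`
of the transpositions of neighbours. -/
structure SymmRelations (s : ℕ → G) (N : ℕ) : Prop where
  sq : ∀ j, j + 1 < N → s j * s j = 1
  braid : ∀ j, j + 2 < N → s j * s (j + 1) * s j = s (j + 1) * s j * s (j + 1)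
  comm : ∀ j k, j + 1 < k → k + 1 < N → s j * s k = s k * s j

theorem SymmRelations.mono (h : SymmRelations s (N + 1)) : SymmRelations s N :=
  ⟨fun j hj => h.sq j (by omega), fun j hj => h.braid j (by omega),
    fun j k hj hk => h.comm j k hj (by omega)⟩

theorem descProd_mul_comm (h : SymmRelations s N) {m : ℕ} : ∀ (d j : ℕ), m + 1 < j → j + d < N →
    descProd s j d * s m = s m * descProd s j d
  | 0, _, _, _ => by simp [descProd]
  | d + 1, j, hm, hd => by
    rw [descProd, mul_assoc, ← h.comm m j hm (by omega), ← mul_assoc,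
      descProd_mul_comm h d (j + 1) (by omega) (by omega), mul_assoc]

/-- The descending product models a cycle, and moving a generator leftwards across it lowers the
index by one: a braid relation does this at one place, commutation elsewhere. -/
theorem descProd_mul_of_lt (h : SymmRelations s N) {m : ℕ} : ∀ (d j : ℕ), j ≤ m → m + 1 < j + d →
    j + d < N → descProd s j d * s (m + 1) = s m * descProd s j d
  | 0, _, _, hm, _ => by omega
  | d + 1, j, hj, hm, hd => by
    rcases hj.eq_or_lt with rfl | hj
    · obtain ⟨d, rfl⟩ : ∃ e, d = e + 1 := ⟨d - 1, by omega⟩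
      have e : s (j + 1) * (s j * s (j + 1)) = s j * (s (j + 1) * s j) := by
        rw [← mul_assoc, ← mul_assoc, h.braid j (by omega)]
      simp only [descProd, mul_assoc]
      rw [e, ← mul_assoc, descProd_mul_comm h d (j + 1 + 1) (by omega) (by omega), mul_assoc]
    · rw [descProd, mul_assoc, h.comm j (m + 1) (by omega) (by omega), ← mul_assoc,
        descProd_mul_of_lt h d (j + 1) (by omega) (by omega) (by omega), mul_assoc]

/-- The subgroup generated by the first `N - 1` members of a sequence. -/
def initClosure (s : ℕ → G) (N : ℕ) : Subgroup G := Subgroup.closure {x | ∃ j, j + 1 < N ∧ x = s j}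

theorem mem_initClosure {j : ℕ} (h : j + 1 < N) : s j ∈ initClosure s N :=
  Subgroup.subset_closure ⟨j, h, rfl⟩

/-- The descending products ending at `N` represent all right cosets of the smaller subgroup.
Multiplying one on the right by a generator lengthens it, shortens it, or passes a generator of the
smaller subgroup to the left. -/
theorem exists_mul_descProd (h : SymmRelations s (N + 1)) {x : G} (hx : x ∈ initClosure s (N + 1)) :
    ∃ y ∈ initClosure s N, ∃ j d, j + d = N ∧ x = y * descProd s j d := by
  have step : ∀ x, (∃ y ∈ initClosure s N, ∃ j d, j + d = N ∧ x = y * descProd s j d) →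
      ∀ m, m + 1 < N + 1 →
      ∃ y ∈ initClosure s N, ∃ j d, j + d = N ∧ x * s m = y * descProd s j d := by
    rintro _ ⟨y, hy, j, d, hjd, rfl⟩ m hm
    rcases lt_trichotomy (m + 1) j with hmj | hmj | hmj
    · refine ⟨y * s m, mul_mem hy (mem_initClosure (by omega)), j, d, hjd, ?_⟩
      rw [mul_assoc, mul_assoc, descProd_mul_comm h d j hmj (by omega)]
    · subst hmj
      exact ⟨y, hy, m, d + 1, by omega, by rw [mul_assoc, descProd]⟩
    · rcases (Nat.lt_succ_iff.mp hmj).eq_or_lt with rfl | hmj'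
      · obtain ⟨d, rfl⟩ : ∃ e, d = e + 1 := ⟨d - 1, by omega⟩
        exact ⟨y, hy, j + 1, d, by omega, by
          rw [descProd, mul_assoc, mul_assoc, h.sq j (by omega), mul_one]⟩
      · obtain ⟨m, rfl⟩ : ∃ e, m = e + 1 := ⟨m - 1, by omega⟩
        refine ⟨y * s m, mul_mem hy (mem_initClosure (by omega)), j, d, hjd, ?_⟩
        rw [mul_assoc, mul_assoc, descProd_mul_of_lt h d j (by omega) (by omega) (by omega)]
  induction hx using Subgroup.closure_induction_right with
  | one => exact ⟨1, one_mem _, N, 0, rfl, by simp [descProd]⟩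
  | mul_right x y hx hy ih =>
    obtain ⟨m, hm, rfl⟩ := hy
    exact step x ih m hm
  | mul_inv_cancel x y hx hy ih =>
    obtain ⟨m, hm, rfl⟩ := hy
    rw [inv_eq_of_mul_eq_one_left (h.sq m hm)]
    exact step x ih m hm

/-- A group with the defining relations of the symmetric group acts faithfully when its generators
act as transpositions of neighbours. -/
theorem eq_one_of_acts_trivially {X : Type*} [DecidableEq X] (φ : G →* Equiv.Perm X) {e : ℕ → X} :
    ∀ {N : ℕ}, SymmRelations s N → Set.InjOn e {j | j < N} →
    (∀ j, j + 1 < N → φ (s j) = Equiv.swap (e j) (e (j + 1))) →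
    ∀ x ∈ initClosure s N, φ x = 1 → x = 1
  | 0, _, _, _, x, hx, _ => by
    simpa [initClosure] using hx
  | N + 1, h, he, hφ, x, hx, hx1 => by
    obtain ⟨y, hy, j, d, hjd, rfl⟩ := exists_mul_descProd h hx
    -- The coset representative carries `e j` to `e N`, which `y` fixes. Since the product acts
    -- trivially, `j = N`, the representative is `1`, and induction applies to `y`.
    have move : ∀ d j, j + d ≤ N → φ (descProd s j d) (e j) = e (j + d) := by
      intro d
      induction d with
      | zero => intro j _; simp [descProd]
      | succ d ih =>
        intro j hj
        rw [descProd, map_mul, Equiv.Perm.mul_apply, hφ j (by omega), Equiv.swap_apply_left,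
          ih (j + 1) (by omega)]
        congr 1
        omega
    have fix : φ y (e N) = e N := by
      have : initClosure s N ≤ (MulAction.stabilizer (Equiv.Perm X) (e N)).comap φ := by
        refine (Subgroup.closure_le _).mpr ?_
        rintro _ ⟨k, hk, rfl⟩
        change φ (s k) (e N) = e N
        rw [hφ k (by omega)]
        refine Equiv.swap_apply_of_ne_of_ne (fun e => ?_) fun e => ?_
        · have := he (Nat.lt_succ_self N) (show k < N + 1 by omega) e
          omega
        · have := he (Nat.lt_succ_self N) (show k + 1 < N + 1 by omega) e
          omega
      exact this hy
    have hj : e j = e N := by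
      have h1 : φ (y * descProd s j d) (e j) = e N := by
        rw [map_mul, Equiv.Perm.mul_apply, move d j hjd.le, hjd, fix]
      rw [← h1, hx1, Equiv.Perm.one_apply]
    have hjN : j = N := he (show j < N + 1 by omega) (Nat.lt_succ_self N) hj
    obtain rfl : d = 0 := by omega
    rw [descProd, mul_one] at hx1 ⊢
    exact eq_one_of_acts_trivially φ h.mono (he.mono fun k (hk : k < N) => Nat.lt_succ_of_lt hk)
      (fun k hk => hφ k (by omega)) y hy hx1

end Coxeter

/-! ### The structure of the group `C^m(p^n)` -/

theorem PHom.permHom_mk {n : ℕ} (f : PTerm n) : PHom.permHom n (PHom.mk f) = f.perm := rfl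

/-- The homomorphism `(f, g) ↦ f ∧ g`. -/
def PHom.andHom (n : ℕ) : PHom n × PHom n →* PHom (n + 1) where
  toFun x := Quotient.map₂ PTerm.and (fun _ _ hf _ _ hg => PEq.and_congr hf hg) x.1 x.2
  map_one' := Quotient.sound (PEq.bif1 n)
  map_mul' := by
    rintro ⟨⟨f⟩, ⟨g⟩⟩ ⟨⟨f'⟩, ⟨g'⟩⟩
    exact Quotient.sound (PEq.bif2 f f' g g')

theorem PHom.mk_and {n : ℕ} (f g : PTerm n) :
    PHom.mk (.and f g) = PHom.andHom n (PHom.mk f, PHom.mk g) := rfl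

theorem PHom.mk_and_sq {n : ℕ} {f g : PTerm n} (hf : PHom.mk f * PHom.mk f = 1)
    (hg : PHom.mk g * PHom.mk g = 1) : PHom.mk (.and f g) * PHom.mk (.and f g) = 1 := by
  rw [PHom.mk_and, ← map_mul, Prod.mk_mul_mk, hf, hg]
  exact map_one _

theorem conj_sq {G : Type*} [Group G] {a b : G} (ha : a * a = 1) (hb : b * b = 1) :
    a * (b * a) * (a * (b * a)) = 1 := by
  rw [mul_assoc, mul_assoc, ← mul_assoc a a, ha, one_mul, ← mul_assoc b b, hb, one_mul, ha]

theorem mk_swapAux_sq {n : ℕ} {s : ℕ → PTerm n} (hs : ∀ j, PHom.mk (s j) * PHom.mk (s j) = 1) :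
    ∀ d j, PHom.mk (swapAux s d j) * PHom.mk (swapAux s d j) = 1
  | 0, j => hs j
  | d + 1, j => by
    simp only [swapAux, ← PHom.mk_mul_mk]
    exact conj_sq (hs j) (mk_swapAux_sq hs d (j + 1))

theorem mk_cm_sq (n : ℕ) : PHom.mk (.cm n) * PHom.mk (.cm n) = 1 := Quotient.sound (PEq.cm_cm n)

/-- Every such term is a palindrome built from involutions, so `c^m ∘ c^m = 1` and bifunctoriality
suffice, whatever the indices. -/
theorem mk_tr_sq : ∀ n i j : ℕ, PHom.mk (tr n i j) * PHom.mk (tr n i j) = 1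
  | 0, _, _ => one_mul _
  | 1, _, _ => one_mul _
  | 2, _, _ => mk_cm_sq 0
  | n + 3, i, j => by
    have hs : ∀ l, PHom.mk (trHalf n i l) * PHom.mk (trHalf n i l) = 1 := by
      intro l
      rw [trHalf]
      split_ifs
      · exact PHom.mk_and_sq (mk_tr_sq _ _ _) (one_mul _)
      · exact PHom.mk_and_sq (one_mul _) (mk_tr_sq _ _ _)
    have hγ := mk_cm_sq (n + 1)
    have hconj : ∀ {a g : PHom (n + 3)}, a * a = 1 → g * g = 1 →
        a * (g * (a * (g * a))) * (a * (g * (a * (g * a)))) = 1 := by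
      intro a g ha hg
      have := conj_sq ha (conj_sq hg ha)
      simpa only [mul_assoc] using this
    by_cases hj : j = (n + 2).choose i
    · subst hj
      rw [tr_choose]
      dsimp only
      split_ifs
      · simp only [← PHom.mk_mul_mk]
        exact hconj (hs _) hγ
      · simp only [← PHom.mk_mul_mk]
        exact hconj (hs _) hγ
      · have := conj_sq (mk_swapAux_sq hs ((n + 2).choose i - ((n + 1).choose i + 1) - 1)
          ((n + 1).choose i + 1)) (hconj (hs ((n + 1).choose i)) hγ)
        simp only [← PHom.mk_mul_mk, swap]
        simpa only [mul_assoc] using this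
    · rw [tr_of_ne hj]
      exact hs j

theorem Valid.mk_tr_mem {n i j : ℕ} (h : Valid n i j) : PHom.mk (tr n i j) ∈ subG n i :=
  Subgroup.subset_closure ⟨j, h, rfl⟩

theorem mk_swapAux_mem {n : ℕ} {s : ℕ → PTerm n} {H : Subgroup (PHom n)} : ∀ d j,
    (∀ l, j ≤ l → l ≤ j + d → PHom.mk (s l) ∈ H) → PHom.mk (swapAux s d j) ∈ H
  | 0, j, h => h j le_rfl le_rfl
  | d + 1, j, h => by
    have hj := h j le_rfl (by omega)
    exact mul_mem hj (mul_mem (mk_swapAux_mem d (j + 1) fun l hl hl' => h l (by omega) (by omega)) hj)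

theorem mk_prodUpTo_mem {n : ℕ} {f : ℕ → PTerm n} {H : Subgroup (PHom n)} : ∀ k,
    (∀ t, t < k → PHom.mk (f (t + 1)) ∈ H) → PHom.mk (prodUpTo f k) ∈ H
  | 0, _ => one_mem H
  | k + 1, h =>
    mul_mem (mk_prodUpTo_mem k fun t ht => h t (by omega)) (h k (Nat.lt_succ_self k))

theorem Valid.and_id {n i j : ℕ} (h : Valid n i j) :
    PHom.mk (.and (tr n i j) (.id n)) ∈ ⨆ i : Fin (n + 2), subG (n + 1) i := by
  obtain ⟨h1, h2, h3, h4⟩ := h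
  obtain ⟨n, rfl⟩ : ∃ m, n = m + 2 := ⟨n - 2, by omega⟩
  have hv : Valid (n + 3) i j := ⟨h1, by omega, h3, h4.trans
    (Nat.choose_le_choose _ (Nat.le_succ _))⟩
  have e : tr (n + 3) i j = .and (tr (n + 2) i j) (.id (n + 2)) := by
    rw [tr_of_ne (by omega), trHalf, if_pos (by omega)]
  rw [← e]
  exact Subgroup.mem_iSup_of_mem (⟨i, by omega⟩ : Fin (n + 4)) hv.mk_tr_mem

theorem Valid.id_and {n i j : ℕ} (h : Valid n i j) :
    PHom.mk (.and (.id n) (tr n i j)) ∈ ⨆ i : Fin (n + 2), subG (n + 1) i := by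
  obtain ⟨h1, h2, h3, h4⟩ := h
  obtain ⟨n, rfl⟩ : ∃ m, n = m + 2 := ⟨n - 2, by omega⟩
  have hv : Valid (n + 3) (i + 1) ((n + 2).choose (i + 1) + j) :=
    ⟨by omega, by omega, by omega, by rw [Nat.choose_succ_succ' (n + 2)]; omega⟩
  have e : tr (n + 3) (i + 1) ((n + 2).choose (i + 1) + j) =
      .and (.id (n + 2)) (tr (n + 2) i j) := by
    rw [tr_of_ne (by omega), trHalf, if_neg (by omega), Nat.add_sub_cancel_left, Nat.add_sub_cancel]
  rw [← e]
  exact Subgroup.mem_iSup_of_mem (⟨i + 1, by omega⟩ : Fin (n + 4)) hv.mk_tr_mem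

/-- Here (def c^m) is used as a proof that `c^m` is redundant as a generator; in height `2` it is
itself the only generator. -/
theorem mk_cm_mem : ∀ n : ℕ, PHom.mk (.cm n) ∈ ⨆ i : Fin (n + 3), subG (n + 2) i
  | 0 => Subgroup.mem_iSup_of_mem (1 : Fin 3)
    (Valid.mk_tr_mem (n := 2) (i := 1) (j := 1) (by simp [Valid]))
  | n + 1 => by
    rw [show PHom.mk (.cm (n + 1)) = PHom.mk (cmProd (n + 2)) from Quotient.sound (PEq.def_cm n)]
    refine mk_prodUpTo_mem _ fun i hi => mk_prodUpTo_mem _ fun t ht => ?_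
    refine Subgroup.mem_iSup_of_mem (⟨i + 1, by omega⟩ : Fin (n + 4)) ?_
    have hb : (n + 2).choose (i + 1) = (n + 1).choose i + (n + 1).choose (i + 1) :=
      Nat.choose_succ_succ' (n + 1) i
    have hc : (n + 3).choose (i + 1) = (n + 2).choose i + (n + 2).choose (i + 1) :=
      Nat.choose_succ_succ' (n + 2) i
    have hd : (n + 1).choose i ≤ (n + 2).choose i := Nat.choose_le_choose _ (Nat.le_succ _)
    change t < (n + 1).choose i at ht
    refine mk_swapAux_mem _ _ fun l hl hl' => Valid.mk_tr_mem ((valid_iff (by omega)).mpr ?_)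
    change (n + 1).choose (i + 1) + (t + 1) ≤ l at hl
    change l ≤ (n + 1).choose (i + 1) + (t + 1) +
      ((n + 2).choose (i + 1) + (t + 1) - ((n + 1).choose (i + 1) + (t + 1)) - 1) at hl'
    change 1 ≤ l ∧ l + 1 ≤ (n + 3).choose (i + 1)
    omega

theorem map_iSup_subG_le {n : ℕ} {f : PHom n →* PHom (n + 1)} {H : Subgroup (PHom (n + 1))}
    (hf : ∀ i j, Valid n i j → f (PHom.mk (tr n i j)) ∈ H) :
    ∀ x ∈ ⨆ i : Fin (n + 1), subG n i, f x ∈ H := by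
  have : ⨆ i : Fin (n + 1), subG n i ≤ H.comap f := by
    refine iSup_le fun i => (Subgroup.closure_le _).mpr ?_
    rintro _ ⟨j, hj, rfl⟩
    exact hf i j hj
  exact fun x hx => this hx

theorem mk_mem_iSup_subG : ∀ {n : ℕ} (f : PTerm n), PHom.mk f ∈ ⨆ i : Fin (n + 1), subG n i
  | _, .id _ => one_mem _
  | _, .cm n => mk_cm_mem n
  | _, .comp g f => mul_mem (mk_mem_iSup_subG g) (mk_mem_iSup_subG f)
  | _, @PTerm.and n f g => by
    -- The factors `f ∧ 1` and `1 ∧ g` are images under homomorphisms that send generators to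
    -- generators of the next height.
    have e : PHom.mk (.and f g) =
        PHom.andHom n (PHom.mk f, 1) * PHom.andHom n (1, PHom.mk g) := by
      rw [← map_mul, Prod.mk_mul_mk, mul_one, one_mul, PHom.mk_and]
    rw [e]
    exact mul_mem
      (map_iSup_subG_le (f := (PHom.andHom n).comp (MonoidHom.inl _ _)) (fun i j h => h.and_id)
        _ (mk_mem_iSup_subG f))
      (map_iSup_subG_le (f := (PHom.andHom n).comp (MonoidHom.inr _ _)) (fun i j h => h.id_and)
        _ (mk_mem_iSup_subG g))

theorem iSup_subG (n : ℕ) : ⨆ i : Fin (n + 1), subG n i = ⊤ :=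
  top_le_iff.mp fun x _ => Quotient.inductionOn x mk_mem_iSup_subG

/-! ### The direct product decomposition and faithfulness of the action -/

theorem subG_commute {n i j : ℕ} (hij : i ≠ j) {x y : PHom n} (hx : x ∈ subG n i)
    (hy : y ∈ subG n j) : Commute x y := by
  have hle : subG n i ≤ Subgroup.centralizer (subG n j) := by
    refine (Subgroup.closure_le _).mpr ?_
    rintro _ ⟨k, hk, rfl⟩
    have : subG n j ≤ Subgroup.centralizer {PHom.mk (tr n i k)} := by
      refine (Subgroup.closure_le _).mpr ?_
      rintro _ ⟨l, hl, rfl⟩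
      refine Subgroup.mem_centralizer_singleton_iff.mpr ?_
      have h1 := hk.1
      have h2 := hk.2.1
      have h3 := hl.1
      have h4 := hl.2.1
      exact Quotient.sound (PEq.norm (by omega) hij.symm hl hk)
    exact Subgroup.mem_centralizer_iff.mpr fun z hz =>
      (Subgroup.mem_centralizer_singleton_iff.mp (this hz))
  exact ((Subgroup.mem_centralizer_iff.mp (hle hx)) y hy).symm

theorem symmRelations_tr {n i : ℕ} (hi : i ≤ n) :
    SymmRelations (fun j => PHom.mk (tr n i (j + 1))) (n.choose i) := by
  have hv : ∀ j, j + 1 < n.choose i → Valid n i (j + 1) := fun j hj =>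
    (valid_iff hi).mpr ⟨by omega, by omega⟩
  refine ⟨fun j _ => mk_tr_sq _ _ _, fun j hj => ?_, fun j k hjk hk => ?_⟩
  -- In smaller heights no weight has three leaves, so there is no such pair of generators; likewise
  -- the distant pairs below need four leaves of one weight, hence height at least `4`.
  · have hn : 3 ≤ n := by
      by_contra hn
      have : n < 3 := by omega
      interval_cases n <;> interval_cases i <;> simp at hj
    rw [mul_assoc, mul_assoc]
    exact Quotient.sound (PEq.yb hn (hv j (by omega)) (hv (j + 1) (by omega)))
  · have hn : 4 ≤ n := by
      by_contra hn
      have : n < 4 := by omega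
      interval_cases n <;> interval_cases i <;> simp [Nat.choose] at hk <;> omega
    have e : k + 1 = j + 1 + (k - j) := by omega
    have := hv k (by omega)
    simp only [e] at this ⊢
    exact Quotient.sound (PEq.perm hn (by omega) (hv j (by omega)) this)

theorem subG_eq_initClosure {n i : ℕ} (hi : i ≤ n) :
    subG n i = initClosure (fun j => PHom.mk (tr n i (j + 1))) (n.choose i) := by
  refine congrArg Subgroup.closure (Set.ext fun x => ⟨?_, ?_⟩)
  · rintro ⟨j, hj, rfl⟩
    obtain ⟨j, rfl⟩ := Nat.exists_eq_add_of_le' hj.2.2.1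
    exact ⟨j, hj.2.2.2, rfl⟩
  · rintro ⟨j, hj, rfl⟩
    exact ⟨j + 1, (valid_iff hi).mpr ⟨by omega, hj⟩, rfl⟩

theorem eq_one_of_mem_subG {n i : ℕ} (hi : i ≤ n) {x : PHom n} (hx : x ∈ subG n i)
    (h : PHom.permHom n x = 1) : x = 1 := by
  rw [subG_eq_initClosure hi] at hx
  exact eq_one_of_acts_trivially (PHom.permHom n) (symmRelations_tr hi) (unrank_injOn n i)
    (fun j hj => perm_tr n i j ((valid_iff hi).mpr ⟨by omega, hj⟩)) x hx h

/-- The arrows of `C^m(p^n)` that fix all leaves satisfying `P`. -/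
def fixing {n : ℕ} (P : Leaf n → Prop) : Subgroup (PHom n) :=
  (⨅ x : {x // P x}, MulAction.stabilizer (Equiv.Perm (Leaf n)) x.1).comap (PHom.permHom n)

theorem mem_fixing {n : ℕ} {P : Leaf n → Prop} {f : PHom n} :
    f ∈ fixing P ↔ ∀ x, P x → PHom.permHom n f x = x := by
  simp [fixing, Subgroup.mem_iInf]

theorem subG_le_fixing (n i : ℕ) : subG n i ≤ fixing fun x => x.weight ≠ i := by
  refine (Subgroup.closure_le _).mpr ?_
  rintro _ ⟨j, hj, rfl⟩
  refine mem_fixing.mpr fun x hx => ?_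
  obtain ⟨j, rfl⟩ := Nat.exists_eq_add_of_le' hj.2.2.1
  have h := hj.2.2.2
  rw [PHom.permHom_mk, perm_tr n i j hj]
  refine Equiv.swap_apply_of_ne_of_ne ?_ ?_
  · rintro rfl
    exact hx (weight_rank_unrank (by omega)).1
  · rintro rfl
    exact hx (weight_rank_unrank (by omega)).1

theorem permHom_eq_one {n i : ℕ} {x : PHom n} (h : x ∈ fixing fun y => y.weight ≠ i)
    (h' : x ∈ fixing fun y => y.weight = i) : PHom.permHom n x = 1 := by
  ext y
  by_cases hy : y.weight = i
  · exact mem_fixing.mp h' y hy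
  · exact mem_fixing.mp h y hy

theorem subG_le_fixing_of_ne {n i j : ℕ} (h : j ≠ i) : subG n j ≤ fixing fun y => y.weight = i :=
  (subG_le_fixing n j).trans fun _ hx => mem_fixing.mpr fun y hy =>
    mem_fixing.mp hx y (hy.trans_ne h.symm)

/-- An element of `G_i` fixes the leaves of weight other than `i`, and a product of elements of the
other subgroups fixes those of weight `i`; a common element acts trivially. -/
theorem iSupIndep_subG (n : ℕ) : iSupIndep fun i : Fin (n + 1) => subG n i := by
  intro i
  rw [Subgroup.disjoint_def]
  intro x hx hx'
  refine eq_one_of_mem_subG (Nat.lt_succ_iff.mp i.2) hx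
    (permHom_eq_one (subG_le_fixing n i hx) ?_)
  exact iSup₂_le (fun j hj => subG_le_fixing_of_ne (Fin.val_ne_of_ne hj)) hx'

theorem isInternalDirectProduct_subG (n : ℕ) :
    IsInternalDirectProduct fun i : Fin (n + 1) => subG n i :=
  ⟨fun _ _ hij _ _ hx hy => subG_commute (Fin.val_ne_of_ne hij) hx hy,
    Subgroup.injective_noncommPiCoprod_of_iSupIndep (iSupIndep_subG n),
    MonoidHom.range_eq_top.mp (Subgroup.noncommPiCoprod_range.trans (iSup_subG n))⟩

theorem permHom_injective (n : ℕ) : Function.Injective (PHom.permHom n) := by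
  rw [injective_iff_map_eq_one]
  intro x hx
  obtain ⟨hcomm, -, hsurj⟩ := isInternalDirectProduct_subG n
  obtain ⟨f, rfl⟩ := hsurj x
  suffices f = 1 by rw [this, map_one]
  funext i
  refine Subtype.ext (eq_one_of_mem_subG (Nat.lt_succ_iff.mp i.2) (f i).2
    (permHom_eq_one (subG_le_fixing n i (f i).2) ?_))
  classical
  have hc : ((Finset.univ : Finset (Fin (n + 1))) : Set (Fin (n + 1))).Pairwise
      (Function.onFun Commute fun j => (f j : PHom n)) :=
    fun j _ k _ hjk => hcomm hjk _ _ (f j).2 (f k).2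
  have e : Subgroup.noncommPiCoprod hcomm f = Finset.univ.noncommProd _ hc := rfl
  -- Once the `i`-th factor is split off, the others fix all leaves of weight `i`, as does the whole
  -- product; so the `i`-th factor does too.
  rw [← Finset.mul_noncommProd_erase _ (Finset.mem_univ i)] at e
  have hprod : Subgroup.noncommPiCoprod hcomm f ∈ fixing fun y => y.weight = (i : ℕ) := by
    refine mem_fixing.mpr fun y _ => ?_
    rw [hx, Equiv.Perm.one_apply]
  rw [e] at hprod
  exact (Subgroup.mul_mem_cancel_right _ (Subgroup.noncommProd_mem _ _ fun j hj =>
    subG_le_fixing_of_ne (Fin.val_ne_of_ne (Finset.ne_of_mem_erase hj)) (f j).2)).mp hprod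

/-- The numbering of the leaves of weight `i`. -/
def unrankEmb (n i : ℕ) : Fin (n.choose i) ↪ Leaf n :=
  ⟨fun j => unrank n i j, fun j k h => Fin.ext (unrank_injOn n i j.2 k.2 h)⟩

theorem viaEmbedding_swap {α β : Type*} [DecidableEq α] [DecidableEq β] (e : α ↪ β) (x y : α) :
    (Equiv.swap x y).viaEmbedding e = Equiv.swap (e x) (e y) := by
  ext z
  by_cases hz : z ∈ Set.range e
  · obtain ⟨z, rfl⟩ := hz
    rw [Equiv.Perm.viaEmbedding_apply, e.injective.map_swap]
  · rw [Equiv.Perm.viaEmbedding_apply_of_notMem _ _ _ hz, Equiv.swap_apply_of_ne_of_ne]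
    · rintro rfl
      exact hz ⟨x, rfl⟩
    · rintro rfl
      exact hz ⟨y, rfl⟩

theorem closure_swap_succ (N : ℕ) :
    Subgroup.closure {f : Equiv.Perm (Fin N) | ∃ (j : ℕ) (h : j + 1 < N),
      f = Equiv.swap ⟨j, by omega⟩ ⟨j + 1, h⟩} = ⊤ := by
  rcases N with _ | N
  · exact Subsingleton.elim _ _
  · have h := Equiv.Perm.mclosure_swap_castSucc_succ N
    rw [eq_top_iff]
    intro f _
    have hf : f ∈ Submonoid.closure (Set.range fun i : Fin N => Equiv.swap i.castSucc i.succ) := by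
      rw [h]
      trivial
    refine (Submonoid.closure_le (S := (Subgroup.closure _).toSubmonoid)).mpr ?_ hf
    rintro _ ⟨i, rfl⟩
    exact Subgroup.subset_closure ⟨i, by omega, rfl⟩

/-- Both sides are generated by the transpositions of neighbouring leaves of weight `i`. -/
theorem map_permHom_subG {n i : ℕ} (hi : i ≤ n) :
    (subG n i).map (PHom.permHom n) =
      (⊤ : Subgroup _).map (Equiv.Perm.viaEmbeddingHom (unrankEmb n i)) := by
  rw [← closure_swap_succ, MonoidHom.map_closure, subG, MonoidHom.map_closure]
  congr 1
  ext f
  constructor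
  · rintro ⟨_, ⟨j, hj, rfl⟩, rfl⟩
    obtain ⟨j, rfl⟩ := Nat.exists_eq_add_of_le' hj.2.2.1
    refine ⟨_, ⟨j, hj.2.2.2, rfl⟩, ?_⟩
    exact (viaEmbedding_swap _ _ _).trans (perm_tr n i j hj).symm
  · rintro ⟨_, ⟨j, hj, rfl⟩, rfl⟩
    have hv : Valid n i (j + 1) := (valid_iff hi).mpr ⟨by omega, hj⟩
    refine ⟨_, ⟨j + 1, hv, rfl⟩, ?_⟩
    exact (perm_tr n i j hv).trans
      (viaEmbedding_swap (unrankEmb n i) ⟨j, by omega⟩ ⟨j + 1, hj⟩).symm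

theorem nonempty_subG_mulEquiv {n i : ℕ} (hi : i ≤ n) :
    Nonempty (subG n i ≃* Equiv.Perm (Fin (n.choose i))) :=
  ⟨((subG n i).equivMapOfInjective _ (permHom_injective n)).trans
    ((MulEquiv.subgroupCongr (map_permHom_subG hi)).trans
      ((Subgroup.equivMapOfInjective ⊤ _ (Equiv.Perm.viaEmbeddingHom_injective _)).symm.trans
        Subgroup.topEquiv))⟩

theorem PEq.of_perm_eq {n : ℕ} {u v : PTerm n} (h : u.perm = v.perm) : PEq u v :=
  Quotient.exact (s := pSetoid n) (permHom_injective n (a₁ := PHom.mk u) (a₂ := PHom.mk v) h)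

/-! ### Addresses -/

/-- The action of an arrow term, its indices being deleted, on the addresses in binary trees. -/
def Skel.act : Skel → List Bool → List Bool
  | .id, w => w
  | .cm, a :: b :: w => b :: a :: w
  | .cm, w => w
  | .comp g f, w => g.act (f.act w)
  | .and f _, false :: w => false :: f.act w
  | .and _ g, true :: w => true :: g.act w
  | .and _ _, [] => []

/-- The address of a leaf of the complete binary tree. -/
def Leaf.addr : {n : ℕ} → Leaf n → List Bool
  | 0, _ => []
  | _ + 1, Sum.inl x => false :: x.addr
  | _ + 1, Sum.inr x => true :: x.addr

theorem Leaf.addr_injective : ∀ {n : ℕ}, Function.Injective (Leaf.addr (n := n))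
  | 0, _, _, _ => rfl
  | _ + 1, Sum.inl _, Sum.inl _, h => congrArg Sum.inl (Leaf.addr_injective (List.cons.inj h).2)
  | _ + 1, Sum.inr _, Sum.inr _, h => congrArg Sum.inr (Leaf.addr_injective (List.cons.inj h).2)
  | _ + 1, Sum.inl _, Sum.inr _, h => by cases (List.cons.inj h).1
  | _ + 1, Sum.inr _, Sum.inl _, h => by cases (List.cons.inj h).1

/-- The arbitrary tail `z` is what later allows comparison with formulae whose letters lie at
different depths. -/
theorem PTerm.act_addr : ∀ {n : ℕ} (f : PTerm n) (x : Leaf n) (z : List Bool),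
    f.skel.act (x.addr ++ z) = (f.perm x).addr ++ z
  | _, .id _, _, _ => rfl
  | _, .cm _, Sum.inl (Sum.inl _), _ => rfl
  | _, .cm _, Sum.inl (Sum.inr _), _ => rfl
  | _, .cm _, Sum.inr (Sum.inl _), _ => rfl
  | _, .cm _, Sum.inr (Sum.inr _), _ => rfl
  | _, .comp g f, x, z => (congrArg g.skel.act (f.act_addr x z)).trans (g.act_addr (f.perm x) z)
  | _, .and f _, Sum.inl x, z => congrArg (List.cons false) (f.act_addr x z)
  | _, .and _ g, Sum.inr x, z => congrArg (List.cons true) (g.act_addr x z)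

/-- The address in a formula of an occurrence of a letter. -/
def Form.addr {L : Type u} : (A : Form L) → Fin A.len → List Bool
  | .letter _, _ => []
  | .and A B, x =>
    Sum.elim (fun y => false :: A.addr y) (fun y => true :: B.addr y)
      ((finSumFinEquiv (m := A.len) (n := B.len)).symm x)

/-- The occurrence in `A ∧ B` of a letter that occurs in `A`. -/
def Form.inl {L : Type u} {A B : Form L} (x : Fin A.len) : Fin (A.and B).len :=
  finSumFinEquiv (m := A.len) (n := B.len) (Sum.inl x)

/-- The occurrence in `A ∧ B` of a letter that occurs in `B`. -/
def Form.inr {L : Type u} {A B : Form L} (x : Fin B.len) : Fin (A.and B).len :=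
  finSumFinEquiv (m := A.len) (n := B.len) (Sum.inr x)

theorem Form.addr_inl {L : Type u} {A B : Form L} (x : Fin A.len) :
    (A.and B).addr (Form.inl x) = false :: A.addr x :=
  congrArg (Sum.elim (fun y => false :: A.addr y) (fun y => true :: B.addr y))
    (finSumFinEquiv.symm_apply_apply (Sum.inl x))

theorem Form.addr_inr {L : Type u} {A B : Form L} (x : Fin B.len) :
    (A.and B).addr (Form.inr x) = true :: B.addr x :=
  congrArg (Sum.elim (fun y => false :: A.addr y) (fun y => true :: B.addr y))
    (finSumFinEquiv.symm_apply_apply (Sum.inr x))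

theorem Form.forall_and {L : Type u} {A B : Form L} {P : Fin (A.and B).len → Prop}
    (hl : ∀ x : Fin A.len, P (Form.inl x)) (hr : ∀ x : Fin B.len, P (Form.inr x)) : ∀ x, P x := by
  intro x
  obtain ⟨x | x, rfl⟩ := (finSumFinEquiv (m := A.len) (n := B.len)).surjective x
  exacts [hl x, hr x]

theorem Form.addr_injective {L : Type u} : ∀ A : Form L, Function.Injective A.addr
  | .letter _ => fun x y _ => Subsingleton.elim (α := Fin 1) x y
  | .and A B => by
    refine Form.forall_and (fun x => Form.forall_and (fun y h => ?_) fun y h => ?_)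
      fun x => Form.forall_and (fun y h => ?_) fun y h => ?_ <;>
    simp only [Form.addr_inl, Form.addr_inr, List.cons.injEq, reduceCtorEq, true_and,
      false_and] at h
    · rw [A.addr_injective h]
    · rw [B.addr_injective h]

section graph

variable {L : Type u} {A B C D : Form L}

theorem Term.graph_id (x : Fin A.len) : (Term.id A).graph x = x := rfl

theorem Term.graph_comp (g : Term B C) (f : Term A B) (x : Fin A.len) :
    (Term.comp g f).graph x = g.graph (f.graph x) := rfl

theorem Term.graph_and_inl (f : Term A B) (g : Term C D) (x : Fin A.len) :
    (Term.and f g).graph (Form.inl x) = Form.inl (f.graph x) :=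
  congrArg (fun t => finSumFinEquiv (Equiv.sumCongr f.graph g.graph t))
    (finSumFinEquiv.symm_apply_apply (Sum.inl x))

theorem Term.graph_and_inr (f : Term A B) (g : Term C D) (x : Fin C.len) :
    (Term.and f g).graph (Form.inr x) = Form.inr (g.graph x) :=
  congrArg (fun t => finSumFinEquiv (Equiv.sumCongr f.graph g.graph t))
    (finSumFinEquiv.symm_apply_apply (Sum.inr x))

theorem Term.graph_cm (x : (Fin A.len ⊕ Fin B.len) ⊕ (Fin C.len ⊕ Fin D.len)) :
    (Term.cm A B C D).graph (finSumFinEquiv (m := A.len + B.len) (n := C.len + D.len)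
      (Equiv.sumCongr finSumFinEquiv finSumFinEquiv x)) =
    finSumFinEquiv (m := A.len + C.len) (n := B.len + D.len)
      (Equiv.sumCongr finSumFinEquiv finSumFinEquiv (Equiv.sumSumSumComm _ _ _ _ x)) := by
  have h : Equiv.sumCongr finSumFinEquiv.symm finSumFinEquiv.symm
      ((finSumFinEquiv (m := A.len + B.len) (n := C.len + D.len)).symm
        (finSumFinEquiv (Equiv.sumCongr finSumFinEquiv finSumFinEquiv x))) = x := by
    rw [Equiv.symm_apply_apply, ← Equiv.sumCongr_symm, Equiv.symm_apply_apply]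
  exact congrArg (fun t => finSumFinEquiv (m := A.len + C.len) (n := B.len + D.len)
    (Equiv.sumCongr finSumFinEquiv finSumFinEquiv (Equiv.sumSumSumComm _ _ _ _ t))) h

theorem Term.graph_cm_inl_inl (x : Fin A.len) :
    (Term.cm A B C D).graph (Form.inl (Form.inl x)) = Form.inl (Form.inl x) :=
  Term.graph_cm (Sum.inl (Sum.inl x))

theorem Term.graph_cm_inl_inr (x : Fin B.len) :
    (Term.cm A B C D).graph (Form.inl (Form.inr x)) = Form.inr (Form.inl x) :=
  Term.graph_cm (Sum.inl (Sum.inr x))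

theorem Term.graph_cm_inr_inl (x : Fin C.len) :
    (Term.cm A B C D).graph (Form.inr (Form.inl x)) = Form.inl (Form.inr x) :=
  Term.graph_cm (Sum.inr (Sum.inl x))

theorem Term.graph_cm_inr_inr (x : Fin D.len) :
    (Term.cm A B C D).graph (Form.inr (Form.inr x)) = Form.inr (Form.inr x) :=
  Term.graph_cm (Sum.inr (Sum.inr x))

end graph

theorem Term.act_addr {L : Type u} : ∀ {A B : Form L} (f : Term A B) (x : Fin A.len)
    (z : List Bool), f.skel.act (A.addr x ++ z) = B.addr (f.graph x) ++ z
  | _, _, .id _, _, _ => rfl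
  | _, _, .cm A B C D, x, z => by
    revert x
    refine Form.forall_and (Form.forall_and (fun x => ?_) fun x => ?_)
      (Form.forall_and (fun x => ?_) fun x => ?_) <;>
    simp only [Term.graph_cm_inl_inl, Term.graph_cm_inl_inr, Term.graph_cm_inr_inl,
      Term.graph_cm_inr_inr, Form.addr_inl, Form.addr_inr] <;>
    rfl
  | _, _, .comp g f, x, z =>
    (congrArg g.skel.act (f.act_addr x z)).trans (g.act_addr (f.graph x) z)
  | _, _, .and f g, x, z => by
    revert x
    refine Form.forall_and (fun x => ?_) fun x => ?_
    · rw [Term.graph_and_inl, Form.addr_inl, Form.addr_inl]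
      exact congrArg (List.cons false) (f.act_addr x z)
    · rw [Term.graph_and_inr, Form.addr_inr, Form.addr_inr]
      exact congrArg (List.cons true) (g.act_addr x z)

/-- The height of the binary tree of a formula. -/
def Form.height {L : Type u} : Form L → ℕ
  | .letter _ => 0
  | .and A B => max A.height B.height + 1

theorem Form.height_pow {L : Type u} (p : L) : ∀ n, (Form.pow p n).height = n
  | 0 => rfl
  | n + 1 => by simp [Form.pow, Form.height, Form.height_pow p n]

theorem Form.exists_addr_append {L : Type u} : ∀ (A : Form L) {n : ℕ}, A.height ≤ n →
    ∀ x : Leaf n, ∃ (y : Fin A.len) (z : List Bool), x.addr = A.addr y ++ z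
  | .letter _, _, _, x => ⟨(0 : Fin 1), x.addr, rfl⟩
  | .and _ _, 0, h, _ => by simp [Form.height] at h
  | .and A B, n + 1, h, Sum.inl x => by
    obtain ⟨y, z, e⟩ := A.exists_addr_append (by simp only [Form.height] at h; omega) x
    refine ⟨Form.inl y, z, ?_⟩
    rw [Form.addr_inl]
    exact congrArg (List.cons false) e
  | .and A B, n + 1, h, Sum.inr x => by
    obtain ⟨y, z, e⟩ := B.exists_addr_append (by simp only [Form.height] at h; omega) x
    refine ⟨Form.inr y, z, ?_⟩
    rw [Form.addr_inr]
    exact congrArg (List.cons true) e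

theorem Leaf.exists_addr_append : ∀ {n : ℕ} (w : List Bool), n ≤ w.length →
    ∃ (x : Leaf n) (z : List Bool), w = x.addr ++ z
  | 0, w, _ => ⟨(), w, rfl⟩
  | _ + 1, [], h => by simp at h
  | n + 1, a :: w, h => by
    obtain ⟨x, z, rfl⟩ := Leaf.exists_addr_append (n := n) w (by simpa using h)
    cases a
    exacts [⟨Sum.inl x, z, rfl⟩, ⟨Sum.inr x, z, rfl⟩]

theorem graph_eq_of_perm_eq {L : Type u} {A B : Form L} {f g : Term A B} {n : ℕ} {u v : PTerm n}
    (hf : f.skel = u.skel) (hg : g.skel = v.skel) (h : u.perm = v.perm) : f.graph = g.graph := by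
  ext1 x
  apply B.addr_injective
  -- The padding makes the word long enough to begin with the address of a leaf of height `n`, so no
  -- bound on the height of `A` is needed; it is cancelled at the end.
  obtain ⟨y, z, e⟩ := Leaf.exists_addr_append (n := n) (A.addr x ++ List.replicate n false)
    (by simp)
  have h1 := f.act_addr x (List.replicate n false)
  have h2 := g.act_addr x (List.replicate n false)
  rw [hf, e, u.act_addr, h] at h1
  rw [hg, e, v.act_addr] at h2
  exact List.append_cancel_right (h1.symm.trans h2)

/-- Since `A` is not higher than the complete tree, the address of each leaf extends the address of
a letter of `A`, where the two skeletons act alike. -/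
theorem perm_eq_of_graph_eq {L : Type u} {A B : Form L} {f g : Term A B} {n : ℕ} {u v : PTerm n}
    (hf : f.skel = u.skel) (hg : g.skel = v.skel) (hA : A.height ≤ n) (h : f.graph = g.graph) :
    u.perm = v.perm := by
  ext1 x
  apply Leaf.addr_injective
  obtain ⟨y, z, e⟩ := A.exists_addr_append hA x
  have h1 := u.act_addr x []
  have h2 := v.act_addr x []
  rw [List.append_nil, List.append_nil, e] at h1 h2
  rw [← h1, ← h2, ← hf, ← hg, f.act_addr, g.act_addr, h]

/-! ### Coherence -/

theorem CEq.graph_eq {L : Type u} {A B : Form L} {f g : Term A B} (h : CEq f g) :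
    f.graph = g.graph := by
  induction h with
  | refl => rfl
  | symm _ ih => exact ih.symm
  | trans _ _ ih ih' => exact ih.trans ih'
  | comp_congr _ _ ih ih' => rw [Term.graph, Term.graph, ih, ih']
  | and_congr _ _ ih ih' => rw [Term.graph, Term.graph, ih, ih']
  | comp_id | id_comp | assoc => rfl
  | bif1 A B =>
    refine Equiv.ext (Form.forall_and (fun x => ?_) fun x => ?_) <;>
    simp only [Term.graph_id, Term.graph_and_inl, Term.graph_and_inr]
  | bif2 =>
    refine Equiv.ext (Form.forall_and (fun x => ?_) fun x => ?_) <;>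
    simp only [Term.graph_comp, Term.graph_and_inl, Term.graph_and_inr]
  | cm_nat f g h j =>
    refine Equiv.ext (Form.forall_and (Form.forall_and (fun x => ?_) fun x => ?_)
      (Form.forall_and (fun x => ?_) fun x => ?_)) <;>
    simp only [Term.graph_comp, Term.graph_and_inl, Term.graph_and_inr, Term.graph_cm_inl_inl,
      Term.graph_cm_inl_inr, Term.graph_cm_inr_inl, Term.graph_cm_inr_inr]
  | cm_cm A B C D =>
    refine Equiv.ext (Form.forall_and (Form.forall_and (fun x => ?_) fun x => ?_)
      (Form.forall_and (fun x => ?_) fun x => ?_)) <;>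
    simp only [Term.graph_id, Term.graph_comp, Term.graph_cm_inl_inl, Term.graph_cm_inl_inr,
      Term.graph_cm_inr_inl, Term.graph_cm_inr_inr]
  | of_pterm h hf hg => exact graph_eq_of_perm_eq hf hg h.perm_eq

/-- Arrow terms preserve the height of formulae, and have the same skeleton as arrow terms of
`C^m(p^n)` for all sufficiently large `n`. -/
theorem Term.exists_pterm {L : Type u} : ∀ {A B : Form L} (f : Term A B),
    B.height = A.height ∧ ∀ n, A.height ≤ n → ∃ u : PTerm n, f.skel = u.skel
  | _, _, .id _ => ⟨rfl, fun n _ => ⟨.id n, rfl⟩⟩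
  | _, _, .cm A B C D => by
    -- Invariance of height is what lets one `n` serve both factors of a composition.
    refine ⟨by simp only [Form.height]; omega, fun n hn => ?_⟩
    obtain ⟨n, rfl⟩ : ∃ m, n = m + 2 := ⟨n - 2, by simp only [Form.height] at hn; omega⟩
    exact ⟨.cm n, rfl⟩
  | _, _, .comp g f => by
    obtain ⟨hf, hf'⟩ := f.exists_pterm
    obtain ⟨hg, hg'⟩ := g.exists_pterm
    refine ⟨hg.trans hf, fun n hn => ?_⟩
    obtain ⟨u, hu⟩ := hf' n hn
    obtain ⟨v, hv⟩ := hg' n (hf.trans_le hn)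
    exact ⟨.comp v u, congrArg₂ Skel.comp hv hu⟩
  | _, _, .and f g => by
    obtain ⟨hf, hf'⟩ := f.exists_pterm
    obtain ⟨hg, hg'⟩ := g.exists_pterm
    refine ⟨by simp only [Form.height, hf, hg], fun n hn => ?_⟩
    simp only [Form.height] at hn
    obtain ⟨n, rfl⟩ : ∃ m, n = m + 1 := ⟨n - 1, by omega⟩
    obtain ⟨u, hu⟩ := hf' n (by omega)
    obtain ⟨v, hv⟩ := hg' n (by omega)
    exact ⟨.and u v, congrArg₂ Skel.and hu hv⟩

theorem CEq.of_graph_eq {L : Type u} {A B : Form L} {f g : Term A B} (h : f.graph = g.graph) :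
    CEq f g := by
  obtain ⟨u, hu⟩ := f.exists_pterm.2 A.height le_rfl
  obtain ⟨v, hv⟩ := g.exists_pterm.2 A.height le_rfl
  exact CEq.of_pterm (PEq.of_perm_eq (perm_eq_of_graph_eq hu hv le_rfl h)) hu hv

theorem functorG_faithful {L : Type u} (h : GraphSound L) : (functorG h).Faithful where
  map_injective {A B} f g hfg := by
    revert f g
    rintro ⟨f⟩ ⟨g⟩ hfg
    exact Quotient.sound (CEq.of_graph_eq hfg)

theorem toEnd_bijective {L : Type u} (p : L) (n : ℕ) : Function.Bijective (PHom.toEnd p n) := by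
  constructor
  · rintro ⟨u⟩ ⟨v⟩ h
    have h' : CEq (u.toTerm p) (v.toTerm p) := Quotient.exact h
    exact Quotient.sound (PEq.of_perm_eq (perm_eq_of_graph_eq (u.skel_toTerm p) (v.skel_toTerm p)
      (Form.height_pow p n).le h'.graph_eq))
  · rintro ⟨f⟩
    obtain ⟨u, hu⟩ := f.exists_pterm.2 n (Form.height_pow p n).le
    -- Two terms of the same type and skeleton are equal in `C^m`, by restoring indices in the two
    -- sides of `u = u` differently.
    exact ⟨PHom.mk u, Quotient.sound (CEq.of_pterm (PEq.refl u) (u.skel_toTerm p) hu)⟩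

end MedialComm

theorem mainTheorem1 (L : Type*) [Nonempty L] :
    (∀ n : ℕ,
      MedialComm.IsInternalDirectProduct (fun i : Fin (n + 1) => MedialComm.subG n i) ∧
      ∀ i : Fin (n + 1),
        Nonempty (MedialComm.subG n i ≃* Equiv.Perm (Fin (n.choose i)))) ∧
    (∀ (p : L) (n : ℕ), Function.Bijective (MedialComm.PHom.toEnd p n)) ∧
    ∃ h : MedialComm.GraphSound L, (MedialComm.functorG h).Faithful :=
  ⟨fun n => ⟨MedialComm.isInternalDirectProduct_subG n,
      fun i => MedialComm.nonempty_subG_mulEquiv (Nat.lt_succ_iff.mp i.2)⟩,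
    MedialComm.toEnd_bijective,
    ⟨fun _ _ _ _ h => h.graph_eq, MedialComm.functorG_faithful _⟩⟩
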